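/- Notation. For complex $p$ with $|p|<1$ and complex $x\neq 0$ let $(x;p)_\infty=\prod_{j\ge 0}(1-xp^j)$ and $\theta(x;p)=(x;p)_\infty\,(p/x;p)_\infty$ (so $\theta(x;0)=1-x$). For a nonnegative integer $k$ and $q\in\mathbb{C}\setminus\{0\}$ let $(x;q,p)_k=\prod_{j=0}^{k-1}\theta(xq^j;p)$ and $(x_1,\dots,x_r;q,p)_k=\prod_{i=1}^r(x_i;q,p)_k$. Theorem. Let $n$ be a nonnegative integer, let $a,b,q$ be nonzero complex numbers and let $p$ be a complex number with $|p|<1$, such that none of the denominators displayed below (for $0\le j\le n$ and $0\le k\le n$) vanishes. Then $$ \sum_{j=0}^{n} \frac{\theta(aq^{4j};p^2)\,\bigl(a^2q^{2n-4},\,q^{-2n},\,aq/b,\,bq/a;\,q^2,p^2\bigr)_j\,(-q^2;q,p)_{2j}\,(a^2;q^4,p^2)_j} {\theta(a;p^2)\,\bigl(q^{6-2n}/a,\,aq^{2n+2},\,bq,\,a^2q/b;\,q^2,p^2\bigr)_j\,(-a/q;q,p)_{2j}\,(q^4;q^4,p^2)_j}\,(-1)^jq^{3j} $$ $$ =\frac{\theta(-a/q^2;p)\,(-q,\,a/q^3;q,p)_n\,(aq^2;q^2,p^2)_n}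 {\theta(-aq^{2n-2};p)\,(-a/q^2,\,q^2;q,p)_n\,(a/q^4;q^2,p^2)_n}\,q^{-n} \sum_{k=0}^{n} \frac{\theta(q^{4k+2};p^2)\,(aq^{n-2},\,q^{-n};q,p)_k\,(bq/a^2;q^2,p^2)_k\,(bq^{1-2k};q^4,p^2)_k} {\theta(q^2;p^2)\,(q^{4-n}/a,\,q^{n+2};q,p)_k\,(bq;q^2,p^2)_k\,(bq^{1-2k}/a^2;q^4,p^2)_k} \Bigl(\frac{-q^2}{a}\Bigr)^{k}. $$ -/

import Mathlib

noncomputable section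

/-- The infinite `p`-shifted factorial `(a; p)_∞ = ∏_{j ≥ 0} (1 - a p^j)`
(the product converges absolutely for `‖p‖ < 1`). -/
def qFactorialInf (a p : ℂ) : ℂ := ∏' j : ℕ, (1 - a * p ^ j)

/-- The modified Jacobi theta function `θ(a; p) = (a; p)_∞ (p / a; p)_∞`,
for `a ≠ 0` and nome `p` with `‖p‖ < 1`. -/
def ellTheta (a p : ℂ) : ℂ := qFactorialInf a p * qFactorialInf (p / a) p

/-- The theta shifted factorial `(a; q, p)_k = ∏_{j = 0}^{k - 1} θ(a q^j; p)`
with base `q` and nome `p`. -/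
def ellFactorial (a q p : ℂ) (k : ℕ) : ℂ := ∏ j ∈ Finset.range k, ellTheta (a * q ^ j) p

end

/-!
Write `θ` for the theta function of nome `p`. The identity follows from two terminating sums,
both of which rest on the three-term addition formula for theta functions (`ellTheta_addition`).
The addition formula is derived from the Jacobi triple product (`triple_product`): after
multiplication by `(p; p)_∞²`, the product `θ(xy) θ(x/y)` is `x` times a `2 × 2` determinant in two
theta series (`ellTheta_mul_ellTheta`), so that the addition formula is a Plücker relation.

*A quadratic summation in mixed nomes* (`quadTerminating_closed`). The addition formula writes the
very-well-poised factor of the summand as a difference of two products. Regrouping the halves of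
neighbouring summands and using the addition formula once more turns the series into a sum of
simpler products (`quadSum_eq`), which takes proportional values for two consecutive lengths
(`quadAux_shift`). The resulting first-order recurrence in the length (`quadTerminating_succ`)
determines the closed form.

*A very-well-poised expansion* (`expTarget_eq_expSum`). The quotient of shifted factorials
containing `b` on the right-hand side is expanded in the quotients
`(aq/b, bq/a; q², p²)_j / (bq, a²q/b; q², p²)_j` occurring on the left. With `κ = q^{2k+1}`, the
same split-and-regroup argument leads to a sum that is visibly symmetric under `κ ↦ q⁴/κ`
(`expAux_mul`, `expSum_reflect`). Since the series is also invariant under `κ ↦ 1/κ`, this relates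
the index `k + 2` to the index `k`.

The expansion is inserted into the right-hand side and the order of summation is interchanged. For
fixed `j`, the inner sum is the quadratic summation with `X = q^{2j+1}`, `B = q²/a` and length
`n - j` (`outerCoeff_mul_expCoupling`), and its closed form gives the coefficient on the left
(`outerConst_mul_quadTerminating`).

These arguments divide by theta functions other than the displayed denominators, and are therefore
carried out for parameters that are multiplicatively independent modulo powers of `p` (`MulIndep`).
Arbitrary parameters are limits of such ones along the curve
`t ↦ (a exp t, q exp t², b exp t³)` (`exists_curve_mulIndep`), and both sides of the identity are
continuous wherever the displayed denominators do not vanish.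
-/

/-! ### The theta function -/

lemma summable_norm_neg_mul_pow {p : ℂ} (hp : ‖p‖ < 1) (x : ℂ) :
    Summable fun j : ℕ => ‖-(x * p ^ j)‖ := by
  simpa [norm_mul, norm_pow] using
    (summable_geometric_of_lt_one (norm_nonneg p) hp).mul_left ‖x‖

lemma multipliable_qFactorialInf {p : ℂ} (hp : ‖p‖ < 1) (x : ℂ) :
    Multipliable fun j : ℕ => 1 - x * p ^ j := by
  simpa [sub_eq_add_neg] using
    multipliable_one_add_of_summable (summable_norm_neg_mul_pow hp x)

lemma qFactorialInf_ne_zero {p x : ℂ} (hp : ‖p‖ < 1) (h : ∀ j : ℕ, 1 - x * p ^ j ≠ 0) :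
    qFactorialInf x p ≠ 0 := by
  simpa [qFactorialInf, sub_eq_add_neg] using
    tprod_one_add_ne_zero_of_summable (f := fun j : ℕ => -(x * p ^ j))
      (by simpa [sub_eq_add_neg] using h) (summable_norm_neg_mul_pow hp x)

/-- The functional equation `(x; p)_∞ = (1 - x) (p x; p)_∞`. -/
lemma qFactorialInf_eq_mul {p : ℂ} (hp : ‖p‖ < 1) (x : ℂ) :
    qFactorialInf x p = (1 - x) * qFactorialInf (p * x) p := by
  unfold qFactorialInf
  have h1 : Multipliable fun j : ℕ => 1 - x * p ^ (j + 1) := by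
    simpa [pow_succ, mul_assoc, mul_comm, mul_left_comm] using
      multipliable_qFactorialInf hp (p * x)
  rw [tprod_eq_zero_mul' (f := fun j : ℕ => 1 - x * p ^ j) h1]
  simp only [pow_zero, mul_one]
  congr 1
  exact tprod_congr fun j => by ring

/-- The product converges locally uniformly in `x`. -/
lemma continuous_qFactorialInf {p : ℂ} (hp : ‖p‖ < 1) :
    Continuous fun x => qFactorialInf x p := by
  rw [continuous_iff_continuousAt]
  intro x₀
  have hK : IsCompact (Metric.closedBall x₀ 1) := isCompact_closedBall x₀ 1
  have hs : Summable fun j : ℕ => (‖x₀‖ + 1) * ‖p‖ ^ j :=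
    (summable_geometric_of_lt_one (norm_nonneg p) hp).mul_left _
  have H := hs.hasProdUniformlyOn_nat_one_add (f := fun (j : ℕ) (x : ℂ) => -(x * p ^ j)) hK
    (.of_forall fun j x hx => by
      have : ‖x‖ ≤ ‖x₀‖ + 1 := by
        have h1 : ‖x - x₀‖ ≤ 1 := by simpa [dist_eq_norm] using hx
        calc ‖x‖ = ‖x₀ + (x - x₀)‖ := by ring_nf
          _ ≤ ‖x₀‖ + ‖x - x₀‖ := norm_add_le _ _
          _ ≤ _ := by linarith
      rw [norm_neg, norm_mul, norm_pow]
      gcongr) (fun _ => by fun_prop)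
  rw [hasProdUniformlyOn_iff_tendstoUniformlyOn] at H
  have hc := H.continuousOn (.of_forall fun s => by fun_prop)
  have := hc.continuousAt (Metric.closedBall_mem_nhds x₀ one_pos)
  simpa [qFactorialInf, sub_eq_add_neg] using this

/-- The modified theta function vanishes only at the integer powers of the nome. For `p = 0` the
condition `x = p ^ r` amounts to `x = 1`, by the convention `0 ^ 0 = 1`. -/
lemma exists_zpow_of_ellTheta_eq_zero {p x : ℂ} (hp : ‖p‖ < 1) (hx : x ≠ 0)
    (h : ellTheta x p = 0) : ∃ r : ℤ, x = p ^ r := by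
  by_contra! hne
  have h1 : qFactorialInf x p ≠ 0 := by
    refine qFactorialInf_ne_zero hp fun j hj => hne (-j) ?_
    have : x * p ^ j = 1 := by linear_combination -hj
    rw [zpow_neg, zpow_natCast]
    exact eq_inv_of_mul_eq_one_left this
  have h2 : qFactorialInf (p / x) p ≠ 0 := by
    refine qFactorialInf_ne_zero hp fun j hj => hne ((j + 1 : ℕ) : ℤ) ?_
    rw [zpow_natCast]
    field_simp at hj
    linear_combination hj
  exact mul_ne_zero h1 h2 h

lemma ellTheta_one (p : ℂ) : ellTheta 1 p = 0 := by
  have : qFactorialInf 1 p = 0 := tprod_of_exists_eq_zero ⟨0, by simp⟩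
  simp [ellTheta, this]

lemma norm_sq_lt_one {p : ℂ} (hp : ‖p‖ < 1) : ‖p ^ 2‖ < 1 := by
  rw [norm_pow]
  exact pow_lt_one₀ (norm_nonneg p) hp two_ne_zero

/-- The inversion formula of the modified theta function. -/
lemma ellTheta_inv {p x : ℂ} (hp : ‖p‖ < 1) (hx : x ≠ 0) :
    ellTheta x⁻¹ p = -x⁻¹ * ellTheta x p := by
  unfold ellTheta
  rw [qFactorialInf_eq_mul hp x⁻¹, qFactorialInf_eq_mul hp x, div_inv_eq_mul, div_eq_mul_inv]
  field_simp
  ring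

lemma ellTheta_zero_right (x : ℂ) : ellTheta x 0 = 1 - x := by
  have h : ∀ y : ℂ, qFactorialInf y 0 = 1 - y := fun y => by
    rw [qFactorialInf_eq_mul (by simp)]
    simp [qFactorialInf]
  simp [ellTheta, h]

lemma continuousAt_ellTheta {p x : ℂ} (hp : ‖p‖ < 1) (hx : x ≠ 0) :
    ContinuousAt (fun x => ellTheta x p) x := by
  unfold ellTheta
  refine (continuous_qFactorialInf hp).continuousAt.mul ?_
  have : ContinuousAt (fun x : ℂ => p / x) x := by fun_prop (disch := assumption)
  exact (continuous_qFactorialInf hp).continuousAt.comp (f := fun x : ℂ => p / x) this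

/-- Passing from nome `p` to nome `p²`. -/
lemma ellTheta_sq {p : ℂ} (hp : ‖p‖ < 1) (x : ℂ) :
    ellTheta (x ^ 2) (p ^ 2) = ellTheta x p * ellTheta (-x) p := by
  have h : ∀ y : ℂ, qFactorialInf (y ^ 2) (p ^ 2) = qFactorialInf y p * qFactorialInf (-y) p := by
    intro y
    unfold qFactorialInf
    rw [← (multipliable_qFactorialInf hp y).tprod_mul (multipliable_qFactorialInf hp (-y))]
    exact tprod_congr fun j => by ring
  unfold ellTheta
  rw [h, ← div_pow, h, div_neg]
  ring

section

open Filter Topology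

/-! ### The Jacobi triple product -/

/-- The Gaussian binomial coefficient, defined through the `q`-Pascal recurrence. -/
def gaussianBinom (p : ℂ) : ℕ → ℕ → ℂ
  | 0, 0 => 1
  | 0, _ + 1 => 0
  | _ + 1, 0 => 1
  | N + 1, k + 1 => p ^ (k + 1) * gaussianBinom p N (k + 1) + gaussianBinom p N k

lemma gaussianBinom_zero_right (p : ℂ) (N : ℕ) : gaussianBinom p N 0 = 1 := by
  cases N <;> rfl

lemma gaussianBinom_of_lt (p : ℂ) : ∀ {N k : ℕ}, N < k → gaussianBinom p N k = 0
  | 0, k + 1, _ => rfl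
  | N + 1, k + 1, h => by
    rw [gaussianBinom, gaussianBinom_of_lt p (by omega : N < k + 1),
      gaussianBinom_of_lt p (by omega : N < k)]
    simp

/-- The finite product `(p; p)_m`. -/
def pFactorial (p : ℂ) (m : ℕ) : ℂ := ∏ j ∈ Finset.range m, (1 - p ^ (j + 1))

lemma pFactorial_succ (p : ℂ) (m : ℕ) :
    pFactorial p (m + 1) = pFactorial p m * (1 - p ^ (m + 1)) := Finset.prod_range_succ _ _

/-- The factorial formula for Gaussian binomials, with denominators cleared so that it holds for
every `p`. -/
lemma gaussianBinom_mul (p : ℂ) (m k : ℕ) :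
    gaussianBinom p (m + k) k * (pFactorial p m * pFactorial p k) = pFactorial p (m + k) := by
  induction h : m + k generalizing m k with
  | zero =>
    obtain ⟨rfl, rfl⟩ : m = 0 ∧ k = 0 := by omega
    simp [gaussianBinom, pFactorial]
  | succ N ih =>
    rcases k with _ | k
    · obtain rfl : m = N + 1 := by omega
      simp [gaussianBinom_zero_right, pFactorial]
    rcases m with _ | m
    · obtain rfl : k = N := by omega
      have h1 := ih 0 k (by omega)
      rw [gaussianBinom, gaussianBinom_of_lt p (by omega : k < k + 1), pFactorial_succ]
      linear_combination (1 - p ^ (k + 1)) * h1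
    · have h1 := ih m (k + 1) (by omega)
      have h2 := ih (m + 1) k (by omega)
      rw [gaussianBinom, pFactorial_succ p N, ← (by omega : m + 1 + k = N)]
      rw [← (by omega : m + 1 + k = N)] at h1 h2
      rw [pFactorial_succ p m] at h2 ⊢
      rw [pFactorial_succ p k] at h1 ⊢
      linear_combination p ^ (k + 1) * (1 - p ^ (m + 1)) * h1 + (1 - p ^ (k + 1)) * h2

/-- The `q`-binomial theorem. -/
lemma prod_one_sub_mul_pow (p : ℂ) (N : ℕ) (y : ℂ) :
    ∏ j ∈ Finset.range N, (1 - y * p ^ j) =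
      ∑ k ∈ Finset.range (N + 1), (-1) ^ k * p ^ (k.choose 2) * gaussianBinom p N k * y ^ k := by
  induction N generalizing y with
  | zero => simp [gaussianBinom]
  | succ N ih =>
    rw [Finset.prod_range_succ', Finset.sum_range_succ', gaussianBinom_zero_right]
    have e : ∏ j ∈ Finset.range N, (1 - y * p ^ (j + 1)) =
        ∏ j ∈ Finset.range N, (1 - (y * p) * p ^ j) :=
      Finset.prod_congr rfl fun j _ => by ring
    rw [e, ih]
    have h0 : ∑ k ∈ Finset.range (N + 1),
        (-1) ^ k * p ^ (k.choose 2) * gaussianBinom p N k * (y * p) ^ k =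
        ∑ k ∈ Finset.range (N + 1), (-1) ^ (k + 1) * p ^ ((k + 1).choose 2) *
          (p ^ (k + 1) * gaussianBinom p N (k + 1)) * y ^ (k + 1) + 1 := by
      have := Finset.sum_range_succ' (fun k =>
        (-1) ^ k * p ^ (k.choose 2) * gaussianBinom p N k * (y * p) ^ k) (N + 1)
      rw [Finset.sum_range_succ, gaussianBinom_of_lt p (by omega : N < N + 1)] at this
      simp only [mul_zero, zero_mul, add_zero] at this
      rw [this, gaussianBinom_zero_right]
      simp only [pow_zero, Nat.choose_zero_succ, mul_one]
      congr 1
      exact Finset.sum_congr rfl fun k _ => by ring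
    simp only [gaussianBinom, mul_add, add_mul, Finset.sum_add_distrib]
    have h1 : ∑ k ∈ Finset.range (N + 1), (-1) ^ (k + 1) * p ^ ((k + 1).choose 2) *
          gaussianBinom p N k * y ^ (k + 1) = -y * ∑ k ∈ Finset.range (N + 1),
        (-1) ^ k * p ^ (k.choose 2) * gaussianBinom p N k * (y * p) ^ k := by
      rw [Finset.mul_sum]
      refine Finset.sum_congr rfl fun k _ => ?_
      rw [Nat.choose_succ_succ' k 1, Nat.choose_one_right]
      ring
    rw [h1, h0]
    simp
    ring

/-- The triangular exponent `l (l - 1) / 2` for an integer `l`. -/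
def triExp (l : ℤ) : ℤ := l * (l - 1) / 2

lemma two_mul_triExp (l : ℤ) : 2 * triExp l = l * (l - 1) :=
  Int.mul_ediv_cancel' (Int.even_mul_pred_self l).two_dvd

lemma triExp_natCast (k : ℕ) : triExp k = (k.choose 2 : ℕ) := by
  have h := two_mul_triExp k
  induction k with
  | zero => simp [triExp]
  | succ k ih =>
    have := ih (two_mul_triExp k)
    have h2 := two_mul_triExp k
    rw [Nat.choose_succ_succ' k 1, Nat.choose_one_right]
    push_cast at *
    linarith

/-- Coefficients of the finite Laurent expansion of the truncated theta function. -/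
def thetaCoeff (p : ℂ) (n : ℕ) (l : ℤ) : ℂ :=
  if -n ≤ l then gaussianBinom p (2 * n) (n + l).toNat else 0

/-- The `q`-binomial theorem with `2 n` factors, centred, is a truncated triple product. -/
lemma finite_triple_product {p x : ℂ} (hp0 : p ≠ 0) (hx : x ≠ 0) (n : ℕ) :
    (∏ j ∈ Finset.range n, (1 - x * p ^ j)) * ∏ j ∈ Finset.range n, (1 - p / x * p ^ j) =
      ∑' l : ℤ, (-1) ^ l * p ^ triExp l * x ^ l * thetaCoeff p n l := by
  have hinj : Function.Injective fun k : ℕ => (k : ℤ) - n := fun a b h => by simpa using h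
  have hsupp : ∑' l : ℤ, (-1) ^ l * p ^ triExp l * x ^ l * thetaCoeff p n l =
      ∑ k ∈ Finset.range (2 * n + 1), (-1) ^ ((k : ℤ) - n) * p ^ triExp (k - n) *
        x ^ ((k : ℤ) - n) * gaussianBinom p (2 * n) k := by
    rw [tsum_eq_sum (s := (Finset.range (2 * n + 1)).map ⟨_, hinj⟩), Finset.sum_map]
    · refine Finset.sum_congr rfl fun k _ => ?_
      simp only [Function.Embedding.coeFn_mk, thetaCoeff]
      rw [if_pos (by omega)]
      congr 2
      omega
    · intro l hl
      simp only [Finset.mem_map, Finset.mem_range, Function.Embedding.coeFn_mk, not_exists,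
        not_and] at hl
      unfold thetaCoeff
      split_ifs with h
      · rw [gaussianBinom_of_lt, mul_zero]
        by_contra hlt
        exact hl (n + l).toNat (by omega) (by omega)
      · simp
  have hq := prod_one_sub_mul_pow p (2 * n) (x * p ^ (-(n : ℤ)))
  rw [two_mul, Finset.prod_range_add] at hq
  have h1 : ∏ j ∈ Finset.range n, (1 - x * p ^ (-(n : ℤ)) * p ^ (n + j)) =
      ∏ j ∈ Finset.range n, (1 - x * p ^ j) := by
    refine Finset.prod_congr rfl fun j _ => ?_
    rw [pow_add, zpow_neg, zpow_natCast]
    field_simp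
  have h2 : ∀ m : ℕ, ∏ j ∈ Finset.range m, (1 - x * p ^ (-(m : ℤ)) * p ^ j) =
      (-x) ^ m * p ^ (-triExp (m + 1)) * ∏ j ∈ Finset.range m, (1 - p / x * p ^ j) := by
    intro m
    induction m with
    | zero => simp [triExp]
    | succ m ih =>
      rw [Finset.prod_range_succ', Finset.prod_range_succ _ m]
      have e : ∏ j ∈ Finset.range m, (1 - x * p ^ (-((m + 1 : ℕ) : ℤ)) * p ^ (j + 1)) =
          ∏ j ∈ Finset.range m, (1 - x * p ^ (-(m : ℤ)) * p ^ j) := by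
        refine Finset.prod_congr rfl fun j _ => ?_
        rw [← zpow_natCast p (j + 1), ← zpow_natCast p j, mul_assoc, mul_assoc, ← zpow_add₀ hp0,
          ← zpow_add₀ hp0]
        congr 3
        push_cast
        ring
      have ht : -triExp (((m + 1 : ℕ) : ℤ) + 1) = -triExp ((m : ℤ) + 1) - (m + 1) := by
        have a1 := two_mul_triExp (((m + 1 : ℕ) : ℤ) + 1)
        have a2 := two_mul_triExp ((m : ℤ) + 1)
        push_cast at *
        linarith
      rw [e, ih, ht, zpow_sub₀ hp0, zpow_neg p ((m + 1 : ℕ) : ℤ), zpow_natCast,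
        show ((m : ℤ) + 1) = ((m + 1 : ℕ) : ℤ) by push_cast; ring, zpow_natCast]
      field_simp
      ring
  rw [h1, h2, ← two_mul] at hq
  rw [hsupp]
  have h3 : ∀ k : ℕ, (-1) ^ ((k : ℤ) - n) * p ^ triExp (k - n) *
        x ^ ((k : ℤ) - n) * gaussianBinom p (2 * n) k =
      ((-x) ^ n * p ^ (-triExp (n + 1)))⁻¹ * ((-1) ^ k * p ^ (k.choose 2) *
        gaussianBinom p (2 * n) k * (x * p ^ (-(n : ℤ))) ^ k) := by
    intro k
    have ht : triExp (k - n) = triExp (n + 1) + k.choose 2 + (-(n : ℤ)) * k := by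
      have a1 := two_mul_triExp ((k : ℤ) - n)
      have a2 := two_mul_triExp ((n : ℤ) + 1)
      have a3 := two_mul_triExp (k : ℤ)
      rw [← triExp_natCast]
      linarith
    rw [ht, zpow_add₀ hp0, zpow_add₀ hp0, zpow_mul, zpow_sub₀ hx, zpow_sub₀ (by norm_num),
      zpow_neg p (triExp _), neg_pow x n]
    simp only [zpow_natCast, mul_inv, inv_inv, mul_pow]
    rw [show ((-1 : ℂ) ^ n)⁻¹ = (-1) ^ n by rw [← inv_pow]; norm_num]
    have : (-1 : ℂ) ^ k / (-1) ^ n = (-1) ^ k * (-1) ^ n := by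
      rw [div_eq_mul_inv, ← inv_pow]; norm_num
    rw [this]
    field_simp
  rw [Finset.sum_congr rfl fun k _ => h3 k, ← Finset.mul_sum, ← hq]
  have : (-x) ^ n * p ^ (-triExp (n + 1)) ≠ 0 :=
    mul_ne_zero (pow_ne_zero _ (neg_ne_zero.mpr hx)) (zpow_ne_zero _ hp0)
  rw [mul_assoc, inv_mul_cancel_left₀ this, mul_comm]

lemma pFactorial_ne_zero {p : ℂ} (hp : ‖p‖ < 1) (m : ℕ) : pFactorial p m ≠ 0 := by
  refine Finset.prod_ne_zero_iff.mpr fun j _ h => ?_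
  have h1 : p ^ (j + 1) = 1 := by linear_combination -h
  have h2 : ‖p‖ ^ (j + 1) < 1 := pow_lt_one₀ (norm_nonneg p) hp (by omega)
  rw [← norm_pow, h1, norm_one] at h2
  exact lt_irrefl _ h2

lemma tendsto_pFactorial {p : ℂ} (hp : ‖p‖ < 1) :
    Tendsto (pFactorial p) atTop (𝓝 (qFactorialInf p p)) := by
  have := (multipliable_qFactorialInf hp p).hasProd.tendsto_prod_nat
  refine this.congr fun m => Finset.prod_congr rfl fun j _ => ?_
  rw [pow_succ']

lemma qFactorialInf_self_ne_zero {p : ℂ} (hp : ‖p‖ < 1) : qFactorialInf p p ≠ 0 := by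
  refine qFactorialInf_ne_zero hp fun j h => ?_
  have := pFactorial_ne_zero hp (j + 1)
  rw [pFactorial_succ, pow_succ' p j, h, mul_zero] at this
  exact this rfl

/-- Uniform boundedness provides the dominating function for the passage to the limit. -/
lemma exists_gaussianBinom_bound {p : ℂ} (hp : ‖p‖ < 1) :
    ∃ M : ℝ, ∀ N k : ℕ, ‖gaussianBinom p N k‖ ≤ M := by
  have h1 := tendsto_pFactorial hp
  have h2 := h1.inv₀ (qFactorialInf_self_ne_zero hp)
  obtain ⟨U, hU⟩ := (Metric.isBounded_range_of_tendsto _ h1).exists_norm_le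
  obtain ⟨V, hV⟩ := (Metric.isBounded_range_of_tendsto _ h2).exists_norm_le
  have hU0 : 0 ≤ U := (norm_nonneg _).trans (hU _ ⟨0, rfl⟩)
  have hV0 : 0 ≤ V := (norm_nonneg _).trans (hV _ ⟨0, rfl⟩)
  refine ⟨U * (V * V), fun N k => ?_⟩
  rcases lt_or_ge N k with h | h
  · rw [gaussianBinom_of_lt p h, norm_zero]
    positivity
  · obtain ⟨m, rfl⟩ := Nat.exists_eq_add_of_le' h
    have : gaussianBinom p (m + k) k =
        pFactorial p (m + k) * ((pFactorial p m)⁻¹ * (pFactorial p k)⁻¹) := by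
      rw [← gaussianBinom_mul]
      field_simp [pFactorial_ne_zero hp m, pFactorial_ne_zero hp k]
    rw [this, norm_mul, norm_mul]
    exact mul_le_mul (hU _ ⟨_, rfl⟩)
      (mul_le_mul (hV _ ⟨m, rfl⟩) (hV _ ⟨k, rfl⟩) (norm_nonneg _) hV0) (by positivity) hU0

lemma tendsto_thetaCoeff {p : ℂ} (hp : ‖p‖ < 1) (l : ℤ) :
    Tendsto (fun n => thetaCoeff p n l) atTop (𝓝 (qFactorialInf p p)⁻¹) := by
  have hP := qFactorialInf_self_ne_zero hp
  have hf := tendsto_pFactorial hp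
  have t0 : Tendsto (fun n : ℕ => 2 * n) atTop atTop :=
    tendsto_atTop_mono (fun n => Nat.le_mul_of_pos_left n two_pos) tendsto_id
  have t1 : Tendsto (fun n : ℕ => (n + l).toNat) atTop atTop :=
    tendsto_atTop_atTop.mpr fun b => ⟨b + l.natAbs, fun n hn => by omega⟩
  have t2 : Tendsto (fun n : ℕ => (n - l).toNat) atTop atTop :=
    tendsto_atTop_atTop.mpr fun b => ⟨b + l.natAbs, fun n hn => by omega⟩
  have key := (hf.comp t0).mul (((hf.comp t2).mul (hf.comp t1)).inv₀ (mul_ne_zero hP hP))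
  have e : qFactorialInf p p * (qFactorialInf p p * qFactorialInf p p)⁻¹ =
      (qFactorialInf p p)⁻¹ := by field_simp
  rw [e] at key
  refine key.congr' ?_
  filter_upwards [eventually_ge_atTop l.natAbs] with n hn
  simp only [Function.comp, thetaCoeff]
  rw [if_pos (by omega)]
  have h := gaussianBinom_mul p (n - l).toNat (n + l).toNat
  rw [show (n - l).toNat + (n + l).toNat = 2 * n by omega] at h
  rw [← h, mul_inv_cancel_right₀
    (mul_ne_zero (pFactorial_ne_zero hp _) (pFactorial_ne_zero hp _))]

/-- Summability of `r ^ e(l) s ^ l` over all integers, for a sequence of exponents `e` that grows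
quadratically. -/
lemma summable_quadratic_zpow {r s : ℝ} (hr0 : 0 < r) (hr : r < 1) (hs : 0 < s) {e : ℤ → ℤ}
    {c d : ℤ} (he : ∀ l, e (l + 1) = e l + c * l + d) (hc : 0 < c) :
    Summable fun l : ℤ => r ^ e l * s ^ l := by
  have hlim : Tendsto (fun n : ℕ => r ^ (c * n)) atTop (𝓝 0) := by
    have h1 : r ^ c < 1 := by
      obtain ⟨m, rfl⟩ := Int.eq_ofNat_of_zero_le hc.le
      rw [zpow_natCast]
      exact pow_lt_one₀ hr0.le hr (by omega)
    simp_rw [zpow_mul, zpow_natCast]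
    exact tendsto_pow_atTop_nhds_zero_of_lt_one (zpow_nonneg hr0.le _) h1
  refine Summable.of_nat_of_neg_add_one ?_ ?_
  · refine summable_of_ratio_test_tendsto_lt_one zero_lt_one
      (.of_forall fun n => (by positivity)) ?_
    have : Tendsto (fun n : ℕ => r ^ (c * n) * (r ^ d * s)) atTop (𝓝 (0 * (r ^ d * s))) :=
      hlim.mul_const _
    rw [zero_mul] at this
    refine this.congr fun n => ?_
    rw [Real.norm_of_nonneg (by positivity), Real.norm_of_nonneg (by positivity)]
    push_cast
    rw [he, zpow_add₀ hr0.ne', zpow_add₀ hr0.ne', zpow_add₀ hs.ne', zpow_one]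
    field_simp
  · refine summable_of_ratio_test_tendsto_lt_one zero_lt_one
      (.of_forall fun n => (by positivity)) ?_
    have : Tendsto (fun n : ℕ => r ^ (c * n) * (r ^ (2 * c - d) * s⁻¹)) atTop
        (𝓝 (0 * (r ^ (2 * c - d) * s⁻¹))) := hlim.mul_const _
    rw [zero_mul] at this
    refine this.congr fun n => ?_
    rw [Real.norm_of_nonneg (by positivity), Real.norm_of_nonneg (by positivity)]
    have h1 : e (-((n : ℤ) + 1)) = e (-(((n + 1 : ℕ) : ℤ) + 1)) - c * n + (d - 2 * c) := by
      have := he (-(((n + 1 : ℕ) : ℤ) + 1))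
      push_cast at *
      rw [show -((n : ℤ) + 1 + 1) + 1 = -((n : ℤ) + 1) by ring] at this
      rw [this]
      ring
    have h2 : s ^ (-((n : ℤ) + 1)) = s ^ (-(((n + 1 : ℕ) : ℤ) + 1)) * s := by
      rw [← zpow_add_one₀ hs.ne', Nat.cast_add_one]
      ring_nf
    rw [h1, h2, zpow_add₀ hr0.ne', zpow_sub₀ hr0.ne', zpow_sub₀ hr0.ne',
      zpow_sub₀ hr0.ne' d]
    field_simp

lemma triExp_add_one (l : ℤ) : triExp (l + 1) = triExp l + l := by
  have h1 := two_mul_triExp (l + 1)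
  have h2 := two_mul_triExp l
  linarith

lemma summable_theta_term {p x : ℂ} (hp0 : p ≠ 0) (hp : ‖p‖ < 1) (hx : x ≠ 0) :
    Summable fun l : ℤ => ‖(-1) ^ l * p ^ triExp l * x ^ l‖ := by
  have := summable_quadratic_zpow (norm_pos_iff.mpr hp0) hp (norm_pos_iff.mpr hx) (e := triExp)
    (c := 1) (d := 0) (fun l => by rw [triExp_add_one]; ring) one_pos
  simpa [norm_mul, norm_zpow] using this

/-- The Jacobi triple product identity. -/
lemma triple_product {p x : ℂ} (hp0 : p ≠ 0) (hp : ‖p‖ < 1) (hx : x ≠ 0) :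
    qFactorialInf p p * ellTheta x p = ∑' l : ℤ, (-1) ^ l * p ^ triExp l * x ^ l := by
  obtain ⟨M, hM⟩ := exists_gaussianBinom_bound hp
  have hM0 : 0 ≤ M := (norm_nonneg _).trans (hM 0 0)
  have h1 : Tendsto (fun n : ℕ => ∑' l : ℤ, (-1) ^ l * p ^ triExp l * x ^ l * thetaCoeff p n l)
      atTop (𝓝 (∑' l : ℤ, (-1) ^ l * p ^ triExp l * x ^ l * (qFactorialInf p p)⁻¹)) := by
    refine tendsto_tsum_of_dominated_convergence
      ((summable_theta_term hp0 hp hx).mul_right M)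
      (fun l => (tendsto_thetaCoeff hp l).const_mul _) (.of_forall fun n l => ?_)
    rw [norm_mul]
    refine mul_le_mul_of_nonneg_left ?_ (norm_nonneg _)
    unfold thetaCoeff
    split_ifs
    · exact hM _ _
    · simpa using hM0
  have h2 := ((multipliable_qFactorialInf hp x).hasProd.tendsto_prod_nat).mul
    ((multipliable_qFactorialInf hp (p / x)).hasProd.tendsto_prod_nat)
  simp_rw [finite_triple_product hp0 hx] at h2
  have h3 := tendsto_nhds_unique h2 h1
  rw [tsum_mul_right] at h3
  rw [ellTheta, show qFactorialInf x p * qFactorialInf (p / x) p = _ from h3, mul_comm,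
    inv_mul_cancel_right₀ (qFactorialInf_self_ne_zero hp)]

/-! ### The addition formula -/

/-- The even theta series `∑ p ^ (l ^ 2) x ^ (2 l)`. -/
noncomputable def evenTheta (p x : ℂ) : ℂ := ∑' l : ℤ, p ^ (l * l) * x ^ (2 * l)

/-- The odd theta series `∑ p ^ (l ^ 2 + l) x ^ (2 l + 1)`. -/
noncomputable def oddTheta (p x : ℂ) : ℂ := ∑' l : ℤ, p ^ (l * l + l) * x ^ (2 * l + 1)

lemma summable_evenTheta {p x : ℂ} (hp0 : p ≠ 0) (hp : ‖p‖ < 1) (hx : x ≠ 0) :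
    Summable fun l : ℤ => ‖p ^ (l * l) * x ^ (2 * l)‖ := by
  have := summable_quadratic_zpow (norm_pos_iff.mpr hp0) hp (s := ‖x‖ ^ (2 : ℤ)) (by positivity)
    (e := fun l => l * l) (c := 2) (d := 1) (fun l => by ring) two_pos
  simpa [norm_mul, norm_zpow, zpow_mul] using this

lemma summable_oddTheta {p x : ℂ} (hp0 : p ≠ 0) (hp : ‖p‖ < 1) (hx : x ≠ 0) :
    Summable fun l : ℤ => ‖p ^ (l * l + l) * x ^ (2 * l + 1)‖ := by
  have := (summable_quadratic_zpow (norm_pos_iff.mpr hp0) hp (s := ‖x‖ ^ (2 : ℤ)) (by positivity)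
    (e := fun l => l * l + l) (c := 2) (d := 2) (fun l => by ring) two_pos).mul_right ‖x‖
  refine this.congr fun l => ?_
  rw [norm_mul, norm_zpow, norm_zpow, zpow_add_one₀ (norm_ne_zero_iff.mpr hx), zpow_mul, mul_assoc]

/-- Integer pairs split by the parity of their sum. -/
def parityMap : (ℤ × ℤ) ⊕ (ℤ × ℤ) → ℤ × ℤ :=
  Sum.elim (fun s => (s.1 + s.2, s.1 - s.2)) (fun s => (s.1 + s.2 + 1, s.1 - s.2))

lemma parityMap_bijective : Function.Bijective parityMap := by
  constructor
  · rintro (⟨a, b⟩ | ⟨a, b⟩) (⟨c, d⟩ | ⟨c, d⟩) h <;>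
      simp only [parityMap, Sum.elim_inl, Sum.elim_inr, Prod.mk.injEq, Sum.inl.injEq,
        Sum.inr.injEq, reduceCtorEq] at h ⊢ <;> omega
  · rintro ⟨m, n⟩
    rcases Int.even_or_odd' (m + n) with ⟨k, hk | hk⟩
    · exact ⟨Sum.inl (k, m - k), by simp only [parityMap, Sum.elim_inl, Prod.mk.injEq]; omega⟩
    · exact ⟨Sum.inr (k, m - k - 1), by simp only [parityMap, Sum.elim_inr, Prod.mk.injEq]; omega⟩

/-- A double series over `(m, n)` split according to the parity of `m + n`. -/
lemma tsum_eq_parity_add {g : ℤ × ℤ → ℂ}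
    (h1 : Summable fun s : ℤ × ℤ => g (s.1 + s.2, s.1 - s.2))
    (h2 : Summable fun s : ℤ × ℤ => g (s.1 + s.2 + 1, s.1 - s.2)) :
    ∑' z, g z = ∑' s : ℤ × ℤ, g (s.1 + s.2, s.1 - s.2) +
      ∑' s : ℤ × ℤ, g (s.1 + s.2 + 1, s.1 - s.2) := by
  rw [← (Equiv.ofBijective _ parityMap_bijective).tsum_eq]
  exact Summable.tsum_sum (f := fun s => g (parityMap s)) h1 h2

lemma mul_oddTheta {p x : ℂ} (hx : x ≠ 0) :
    x * oddTheta p x = ∑' l : ℤ, p ^ (l * l - l) * x ^ (2 * l) := by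
  rw [oddTheta, ← tsum_mul_left,
    ← (Equiv.addRight (1 : ℤ)).tsum_eq (fun l : ℤ => p ^ (l * l - l) * x ^ (2 * l))]
  refine tsum_congr fun l => ?_
  rw [Equiv.coe_addRight, show (l + 1) * (l + 1) - (l + 1) = l * l + l by ring,
    show 2 * (l + 1) = (2 * l + 1) + 1 by ring, zpow_add_one₀ hx (2 * l + 1)]
  ring

lemma theta_term_mul_even {p x y : ℂ} (hp0 : p ≠ 0) (hx : x ≠ 0) (hy : y ≠ 0) (S D : ℤ) :
    (-1) ^ (S + D) * p ^ triExp (S + D) * (x * y) ^ (S + D) *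
    ((-1) ^ (S - D) * p ^ triExp (S - D) * (x / y) ^ (S - D)) =
    p ^ (S * S - S) * x ^ (2 * S) * (p ^ (D * D) * y ^ (2 * D)) := by
  have h1 : triExp (S + D) + triExp (S - D) = (S * S - S) + D * D := by
    have := two_mul_triExp (S + D)
    have := two_mul_triExp (S - D)
    linarith
  have h2 : (-1 : ℂ) ^ (S + D) * (-1) ^ (S - D) = 1 := by
    rw [← zpow_add₀ (by norm_num), show S + D + (S - D) = 2 * S by ring, zpow_mul]
    norm_num
  calc _ = ((-1 : ℂ) ^ (S + D) * (-1) ^ (S - D)) * (p ^ triExp (S + D) * p ^ triExp (S - D)) *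
        ((x * y) ^ (S + D) * (x / y) ^ (S - D)) := by ring
    _ = _ := by
      rw [h2, ← zpow_add₀ hp0, h1, zpow_add₀ hp0, mul_zpow, div_zpow,
        show 2 * S = (S + D) + (S - D) by ring, show 2 * D = (S + D) - (S - D) by ring,
        zpow_add₀ hx (S + D), zpow_sub₀ hy (S + D)]
      ring

lemma theta_term_mul_odd {p x y : ℂ} (hp0 : p ≠ 0) (hx : x ≠ 0) (hy : y ≠ 0) (S D : ℤ) :
    (-1) ^ (S + D + 1) * p ^ triExp (S + D + 1) * (x * y) ^ (S + D + 1) *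
    ((-1) ^ (S - D) * p ^ triExp (S - D) * (x / y) ^ (S - D)) =
    -(x * (p ^ (S * S) * x ^ (2 * S))) * (p ^ (D * D + D) * y ^ (2 * D + 1)) := by
  have h1 : triExp (S + D + 1) + triExp (S - D) = S * S + (D * D + D) := by
    have := two_mul_triExp (S + D + 1)
    have := two_mul_triExp (S - D)
    linarith
  have h2 : (-1 : ℂ) ^ (S + D + 1) * (-1) ^ (S - D) = -1 := by
    rw [← zpow_add₀ (by norm_num), show S + D + 1 + (S - D) = 2 * S + 1 by ring,
      zpow_add_one₀ (by norm_num), zpow_mul]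
    norm_num
  calc _ = ((-1 : ℂ) ^ (S + D + 1) * (-1) ^ (S - D)) *
        (p ^ triExp (S + D + 1) * p ^ triExp (S - D)) *
        ((x * y) ^ (S + D + 1) * (x / y) ^ (S - D)) := by ring
    _ = -(p ^ (S * S) * x ^ (2 * S + 1)) * (p ^ (D * D + D) * y ^ (2 * D + 1)) := by
      rw [h2, ← zpow_add₀ hp0, h1, zpow_add₀ hp0, mul_zpow, div_zpow,
        show 2 * S + 1 = (S + D + 1) + (S - D) by ring,
        show 2 * D + 1 = (S + D + 1) - (S - D) by ring,
        zpow_add₀ hx (S + D + 1), zpow_sub₀ hy (S + D + 1)]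
      ring
    _ = _ := by rw [zpow_add_one₀ hx (2 * S)]; ring

/-- The product `θ(xy) θ(x/y)` is antisymmetric and bilinear in a pair of theta series; this is
what makes the three-term addition formula a Plücker relation. -/
lemma ellTheta_mul_ellTheta {p x y : ℂ} (hp0 : p ≠ 0) (hp : ‖p‖ < 1) (hx : x ≠ 0) (hy : y ≠ 0) :
    qFactorialInf p p ^ 2 * (ellTheta (x * y) p * ellTheta (x / y) p) =
      x * (oddTheta p x * evenTheta p y - evenTheta p x * oddTheta p y) := by
  have hxy : x * y ≠ 0 := mul_ne_zero hx hy
  have hxy' : x / y ≠ 0 := div_ne_zero hx hy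
  have e : qFactorialInf p p ^ 2 * (ellTheta (x * y) p * ellTheta (x / y) p) =
      (qFactorialInf p p * ellTheta (x * y) p) * (qFactorialInf p p * ellTheta (x / y) p) := by
    ring
  have s1 := summable_theta_term hp0 hp hxy
  have s2 := summable_theta_term hp0 hp hxy'
  rw [e, triple_product hp0 hp hxy, triple_product hp0 hp hxy',
    tsum_mul_tsum_of_summable_norm s1 s2]
  have sodd : Summable fun l : ℤ => ‖p ^ (l * l - l) * x ^ (2 * l)‖ := by
    have := summable_quadratic_zpow (norm_pos_iff.mpr hp0) hp (s := ‖x‖ ^ (2 : ℤ))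
      (by positivity) (e := fun l => l * l - l) (c := 2) (d := 0) (fun l => by ring) two_pos
    simpa [norm_mul, norm_zpow, zpow_mul] using this
  have sx : Summable fun l : ℤ => ‖-(x * (p ^ (l * l) * x ^ (2 * l)))‖ := by
    simpa [norm_mul] using (summable_evenTheta hp0 hp hx).mul_left ‖x‖
  have f1 : (fun s : ℤ × ℤ => p ^ (s.1 * s.1 - s.1) * x ^ (2 * s.1) *
      (p ^ (s.2 * s.2) * y ^ (2 * s.2))) = fun s : ℤ × ℤ =>
      (-1) ^ (s.1 + s.2) * p ^ triExp (s.1 + s.2) * (x * y) ^ (s.1 + s.2) *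
      ((-1) ^ (s.1 - s.2) * p ^ triExp (s.1 - s.2) * (x / y) ^ (s.1 - s.2)) :=
    funext fun s => (theta_term_mul_even hp0 hx hy s.1 s.2).symm
  have f2 : (fun s : ℤ × ℤ => -(x * (p ^ (s.1 * s.1) * x ^ (2 * s.1))) *
      (p ^ (s.2 * s.2 + s.2) * y ^ (2 * s.2 + 1))) = fun s : ℤ × ℤ =>
      (-1) ^ (s.1 + s.2 + 1) * p ^ triExp (s.1 + s.2 + 1) * (x * y) ^ (s.1 + s.2 + 1) *
      ((-1) ^ (s.1 - s.2) * p ^ triExp (s.1 - s.2) * (x / y) ^ (s.1 - s.2)) :=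
    funext fun s => (theta_term_mul_odd hp0 hx hy s.1 s.2).symm
  have b1 := summable_mul_of_summable_norm sodd (summable_evenTheta hp0 hp hy)
  have b2 := summable_mul_of_summable_norm sx (summable_oddTheta hp0 hp hy)
  have c1 := tsum_mul_tsum_of_summable_norm sodd (summable_evenTheta hp0 hp hy)
  have c2 := tsum_mul_tsum_of_summable_norm sx (summable_oddTheta hp0 hp hy)
  rw [f1] at b1 c1
  rw [f2] at b2 c2
  refine (tsum_eq_parity_add (g := fun z => (-1) ^ z.1 * p ^ triExp z.1 * (x * y) ^ z.1 *
    ((-1) ^ z.2 * p ^ triExp z.2 * (x / y) ^ z.2)) b1 b2).trans ?_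
  rw [← c1, ← c2, ← mul_oddTheta hx, tsum_neg, tsum_mul_left]
  change x * oddTheta p x * evenTheta p y + -(x * evenTheta p x) * oddTheta p y = _
  ring

/-- The three-term addition formula for theta functions, in the symmetric parametrization. -/
lemma ellTheta_addition_symm {p x y u v : ℂ} (hp : ‖p‖ < 1) (hx : x ≠ 0) (hy : y ≠ 0)
    (hu : u ≠ 0) (hv : v ≠ 0) :
    ellTheta (x * y) p * ellTheta (x / y) p * (ellTheta (u * v) p * ellTheta (u / v) p) -
      ellTheta (x * v) p * ellTheta (x / v) p * (ellTheta (u * y) p * ellTheta (u / y) p) =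
    u / y * (ellTheta (y * v) p * ellTheta (y / v) p *
      (ellTheta (x * u) p * ellTheta (x / u) p)) := by
  rcases eq_or_ne p 0 with rfl | hp0
  · simp only [ellTheta_zero_right]
    field_simp
    ring
  have hP := pow_ne_zero 4 (qFactorialInf_self_ne_zero hp)
  have hm : ∀ {s t : ℂ}, s ≠ 0 → t ≠ 0 → _ := fun hs ht => ellTheta_mul_ellTheta hp0 hp hs ht
  have h1 := hm hx hy
  have h2 := hm hu hv
  have h3 := hm hx hv
  have h4 := hm hu hy
  have h5 := hm hy hv
  have h6 := hm hx hu
  apply mul_left_cancel₀ hP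
  calc _ = (qFactorialInf p p ^ 2 * (ellTheta (x * y) p * ellTheta (x / y) p)) *
        (qFactorialInf p p ^ 2 * (ellTheta (u * v) p * ellTheta (u / v) p)) -
        (qFactorialInf p p ^ 2 * (ellTheta (x * v) p * ellTheta (x / v) p)) *
        (qFactorialInf p p ^ 2 * (ellTheta (u * y) p * ellTheta (u / y) p)) := by ring
    _ = u / y * ((qFactorialInf p p ^ 2 * (ellTheta (y * v) p * ellTheta (y / v) p)) *
        (qFactorialInf p p ^ 2 * (ellTheta (x * u) p * ellTheta (x / u) p))) := by
      rw [h1, h2, h3, h4, h5, h6]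
      field_simp
      ring
    _ = _ := by ring

/-- The addition formula free of square roots: the four arguments of each of the first two terms
are `A, B, C, ABC/w²` and `w, AB/w, AC/w, BC/w`. -/
lemma ellTheta_addition {p A B C w : ℂ} (hp : ‖p‖ < 1) (hA : A ≠ 0) (hB : B ≠ 0)
    (hC : C ≠ 0) (hw : w ≠ 0) :
    ellTheta A p * ellTheta B p * ellTheta C p * ellTheta (A * B * C / w ^ 2) p -
      ellTheta w p * ellTheta (A * B / w) p * ellTheta (A * C / w) p * ellTheta (B * C / w) p =
    B * C / w * (ellTheta (w / B) p * ellTheta (A / w) p * ellTheta (A * B * C / w) p *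
      ellTheta (w / C) p) := by
  obtain ⟨x, hx2⟩ := IsAlgClosed.exists_pow_nat_eq (A * B) two_pos
  have hx : x ≠ 0 := by
    rintro rfl
    exact mul_ne_zero hA hB (by rw [← hx2]; ring)
  have h := ellTheta_addition_symm hp hx (div_ne_zero hA hx) (div_ne_zero (mul_ne_zero hC hx) hw)
    (div_ne_zero hw hx)
  have e1 : x * (A / x) = A := by field_simp
  have e2 : x / (A / x) = B := by field_simp; linear_combination hx2
  have e3 : C * x / w * (w / x) = C := by field_simp
  have e4 : C * x / w / (w / x) = A * B * C / w ^ 2 := by field_simp; linear_combination hx2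
  have e5 : x * (w / x) = w := by field_simp
  have e6 : x / (w / x) = A * B / w := by field_simp; linear_combination hx2
  have e7 : C * x / w * (A / x) = A * C / w := by field_simp
  have e8 : C * x / w / (A / x) = B * C / w := by field_simp; linear_combination hx2
  have e9 : A / x * (w / x) = w / B := by field_simp; linear_combination -hx2
  have e10 : A / x / (w / x) = A / w := by field_simp
  have e11 : x * (C * x / w) = A * B * C / w := by field_simp; linear_combination hx2
  have e12 : x / (C * x / w) = w / C := by field_simp
  rw [e1, e2, e3, e4, e5, e6, e7, e8, e9, e10, e11, e12] at h
  linear_combination h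

end

/-! ### Theta shifted factorials -/

lemma ellFactorial_zero (x q p : ℂ) : ellFactorial x q p 0 = 1 := Finset.prod_range_zero _

lemma ellFactorial_succ (x q p : ℂ) (k : ℕ) :
    ellFactorial x q p (k + 1) = ellFactorial x q p k * ellTheta (x * q ^ k) p :=
  Finset.prod_range_succ _ _

lemma ellFactorial_succ_left (x q p : ℂ) (k : ℕ) :
    ellFactorial x q p (k + 1) = ellTheta x p * ellFactorial (x * q) q p k := by
  unfold ellFactorial
  rw [Finset.prod_range_succ', mul_comm]
  simp only [pow_zero, mul_one, pow_succ', mul_assoc]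

lemma ellFactorial_ne_zero {x q p : ℂ} (h : ∀ i : ℕ, ellTheta (x * q ^ i) p ≠ 0) (k : ℕ) :
    ellFactorial x q p k ≠ 0 := Finset.prod_ne_zero_iff.mpr fun i _ => h i

lemma ellFactorial_eq_zero {x q p : ℂ} {i k : ℕ} (hi : i < k) (h : x * q ^ i = 1) :
    ellFactorial x q p k = 0 :=
  Finset.prod_eq_zero (Finset.mem_range.mpr hi) (by rw [h, ellTheta_one])

lemma ellFactorial_add (x q p : ℂ) (j i : ℕ) :
    ellFactorial x q p (j + i) = ellFactorial x q p j * ellFactorial (x * q ^ j) q p i := by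
  unfold ellFactorial
  rw [Finset.prod_range_add]
  simp only [pow_add, mul_assoc]

lemma ellFactorial_sq {p : ℂ} (hp : ‖p‖ < 1) (x q : ℂ) (k : ℕ) :
    ellFactorial (x ^ 2) (q ^ 2) (p ^ 2) k = ellFactorial x q p k * ellFactorial (-x) q p k := by
  unfold ellFactorial
  rw [← Finset.prod_mul_distrib]
  refine Finset.prod_congr rfl fun i _ => ?_
  rw [show x ^ 2 * (q ^ 2) ^ i = (x * q ^ i) ^ 2 by ring, ellTheta_sq hp, neg_mul]

/-- Reversal of the last `j` factors of a shifted factorial; `y` is the argument of its last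
theta function. -/
lemma ellFactorial_add_reverse {p q x y : ℂ} (hp : ‖p‖ < 1) (hq : q ≠ 0) (hx : x ≠ 0) (N j : ℕ)
    (hy : y * q = x * q ^ (N + j)) :
    ellFactorial x q p (N + j) = ellFactorial x q p N *
      ((∏ l ∈ Finset.range j, -(y / q ^ l)) * ellFactorial y⁻¹ q p j) := by
  induction j generalizing y with
  | zero => simp [ellFactorial_zero]
  | succ j ih =>
    have hy' : y = x * q ^ (N + j) := mul_right_cancel₀ hq (by rw [hy]; ring)
    have hy0 : y ≠ 0 := by rw [hy']; positivity
    have hi := ellTheta_inv (x := y) hp hy0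
    rw [← add_assoc, ellFactorial_succ, ih (y := y / q) (by rw [← hy']; field_simp), ← hy',
      Finset.prod_range_succ', ellFactorial_succ_left y⁻¹, hi, inv_div,
      show y⁻¹ * q = q / y by ring]
    simp only [div_div, ← pow_succ', pow_zero, div_one]
    field_simp

/-! ### A quadratic summation in mixed nomes -/

/-- The summand of the quadratic summation, without its very-well-poised part
`θ(X² q^{4i}; p²) q^{2i}`. The parameters `X²` and `B` enter with base `q²` and nome `p²`, the
parameters `C` and `D` with base `q` and nome `p`. -/
noncomputable def quadWeight (p q X B C D : ℂ) (i : ℕ) : ℂ :=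
  ellFactorial (X ^ 2) (q ^ 2) (p ^ 2) i * ellFactorial B (q ^ 2) (p ^ 2) i *
    (ellFactorial C q p i * ellFactorial D q p i) /
  (ellFactorial (q ^ 2) (q ^ 2) (p ^ 2) i * ellFactorial (X ^ 2 * q ^ 2 / B) (q ^ 2) (p ^ 2) i *
    (ellFactorial (X * q / C) q p i * ellFactorial (X * q / D) q p i))

/-- The auxiliary product to which the quadratic series reduces up to a telescoping part. -/
noncomputable def quadAux (p q X B C D : ℂ) (i : ℕ) : ℂ :=
  q ^ i * ellTheta (X * q ^ (2 * i + 1)) p *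
    (ellFactorial (X ^ 2) (q ^ 2) (p ^ 2) (i + 1) * ellFactorial B (q ^ 2) (p ^ 2) (i + 1) *
      (ellFactorial C q p i * ellFactorial D q p (i + 1))) /
  (ellFactorial (q ^ 2) (q ^ 2) (p ^ 2) i * ellFactorial (X ^ 2 * q ^ 2 / B) (q ^ 2) (p ^ 2) i *
    (ellFactorial (X * q / C) q p (i + 1) * ellFactorial (X * q / D) q p i))

/-- The very-well-poised factor is a difference of two products of theta functions, each of which
can be absorbed into the shifted factorials of `quadWeight`. -/
lemma quad_split {p X B D z : ℂ} (hp : ‖p‖ < 1) (hX : X ≠ 0) (hB : B ≠ 0) (hD : D ≠ 0)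
    (hz : z ≠ 0) :
    B * D ^ 2 * (ellTheta B⁻¹ p * ellTheta (D ^ 2)⁻¹ p * ellTheta (X ^ 2 / (B * D ^ 2)) p) *
        (z ^ 2 * ellTheta (X ^ 2 * z ^ 4) p) =
      ellTheta (X ^ 2 * z ^ 2) p * ellTheta (B * z ^ 2) p * ellTheta (D ^ 2 * z ^ 2) p *
        ellTheta (X ^ 2 * z ^ 2 / (B * D ^ 2)) p -
      ellTheta (z ^ 2) p * ellTheta (X ^ 2 * z ^ 2 / B) p * ellTheta (X ^ 2 * z ^ 2 / D ^ 2) p *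
        ellTheta (B * D ^ 2 * z ^ 2) p := by
  have h := ellTheta_addition (A := X ^ 2 * z ^ 4) (B := B⁻¹) (C := (D ^ 2)⁻¹) (w := z ^ 2) hp
    (by positivity) (by positivity) (by positivity) (by positivity)
  have hi := ellTheta_inv (x := B * D ^ 2 * z ^ 2) hp (by positivity)
  rw [show X ^ 2 * z ^ 4 * B⁻¹ * (D ^ 2)⁻¹ / (z ^ 2) ^ 2 = X ^ 2 / (B * D ^ 2) by field_simp,
    show X ^ 2 * z ^ 4 * B⁻¹ / z ^ 2 = X ^ 2 * z ^ 2 / B by field_simp,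
    show X ^ 2 * z ^ 4 * (D ^ 2)⁻¹ / z ^ 2 = X ^ 2 * z ^ 2 / D ^ 2 by field_simp,
    show B⁻¹ * (D ^ 2)⁻¹ / z ^ 2 = (B * D ^ 2 * z ^ 2)⁻¹ by field_simp, hi,
    show z ^ 2 / B⁻¹ = B * z ^ 2 by field_simp,
    show X ^ 2 * z ^ 4 / z ^ 2 = X ^ 2 * z ^ 2 by field_simp,
    show X ^ 2 * z ^ 4 * B⁻¹ * (D ^ 2)⁻¹ / z ^ 2 = X ^ 2 * z ^ 2 / (B * D ^ 2) by field_simp,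
    show z ^ 2 / (D ^ 2)⁻¹ = D ^ 2 * z ^ 2 by field_simp] at h
  have hne : B * D ^ 2 * z ^ 2 ≠ 0 := by positivity
  have hm := mul_inv_cancel₀ hne
  generalize (B * D ^ 2 * z ^ 2)⁻¹ = m at h hm
  linear_combination B * D ^ 2 * z ^ 2 * h + (ellTheta (X ^ 2 * z ^ 2) p * ellTheta (B * z ^ 2) p *
    ellTheta (D ^ 2 * z ^ 2) p * ellTheta (X ^ 2 * z ^ 2 / (B * D ^ 2)) p -
    ellTheta (z ^ 2) p * ellTheta (X ^ 2 * z ^ 2 / B) p * ellTheta (X ^ 2 * z ^ 2 / D ^ 2) p *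
      ellTheta (B * D ^ 2 * z ^ 2) p) * hm

/-- Recombination of the two halves of the split very-well-poised factor. -/
lemma quad_combine {p q X B D z : ℂ} (hp : ‖p‖ < 1) (hq : q ≠ 0) (hX : X ≠ 0) (hB : B ≠ 0)
    (hD : D ≠ 0) (hz : z ≠ 0) :
    ellTheta (-(D * z)) p * ellTheta (X ^ 2 * z ^ 2 / (B * D ^ 2)) (p ^ 2) *
        ellTheta (B * q ^ 2 * D * z) p -
      ellTheta (-(X * q * z / D)) p * ellTheta (B * D ^ 2 * q ^ 2 * z ^ 2) (p ^ 2) *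
        ellTheta (X * z / (q * B * D)) p =
    X * z / (q * B * D) * (ellTheta (q ^ 2 * B) (p ^ 2) * ellTheta (-(q * B * D ^ 2 / X)) p *
      ellTheta (q * X * z ^ 2) p) := by
  -- a square root of `B` factors the theta functions of nome `p ^ 2` into ones of nome `p`
  obtain ⟨β, rfl⟩ := IsAlgClosed.exists_pow_nat_eq B two_pos
  have hβ : β ≠ 0 := by rintro rfl; simp at hB
  have h := ellTheta_addition (A := β ^ 2 * q ^ 2 * D * z) (B := X * z / (β * D))
    (C := -(X * z / (β * D))) (w := -(X * q * z / D)) hp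
    (by positivity) (by positivity) (neg_ne_zero.mpr (by positivity))
    (neg_ne_zero.mpr (by positivity))
  rw [show β ^ 2 * q ^ 2 * D * z * (X * z / (β * D)) * -(X * z / (β * D)) /
      (-(X * q * z / D)) ^ 2 = -(D * z) by field_simp,
    show β ^ 2 * q ^ 2 * D * z * (X * z / (β * D)) / -(X * q * z / D) = -(β * D * q * z) by
      field_simp,
    show β ^ 2 * q ^ 2 * D * z * -(X * z / (β * D)) / -(X * q * z / D) = β * D * q * z by
      field_simp,
    show X * z / (β * D) * -(X * z / (β * D)) / -(X * q * z / D) = X * z / (q * β ^ 2 * D) by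
      field_simp,
    show -(X * q * z / D) / (X * z / (β * D)) = -(q * β) by field_simp,
    show β ^ 2 * q ^ 2 * D * z / -(X * q * z / D) = -(q * β ^ 2 * D ^ 2 / X) by field_simp,
    show β ^ 2 * q ^ 2 * D * z * (X * z / (β * D)) * -(X * z / (β * D)) / -(X * q * z / D) =
      q * X * z ^ 2 by field_simp,
    show -(X * q * z / D) / -(X * z / (β * D)) = q * β by field_simp] at h
  rw [show X ^ 2 * z ^ 2 / (β ^ 2 * D ^ 2) = (X * z / (β * D)) ^ 2 by field_simp,
    show β ^ 2 * D ^ 2 * q ^ 2 * z ^ 2 = (β * D * q * z) ^ 2 by ring,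
    show q ^ 2 * β ^ 2 = (q * β) ^ 2 by ring, ellTheta_sq hp, ellTheta_sq hp, ellTheta_sq hp]
  linear_combination h

/-- The normalization constant in `quad_split`. -/
noncomputable def quadConst (p X B D : ℂ) : ℂ :=
  B * D ^ 2 * (ellTheta B⁻¹ p * ellTheta (D ^ 2)⁻¹ p * ellTheta (X ^ 2 / (B * D ^ 2)) p)

/-- The tail left over when the quadratic series is reduced to `quadAux`. -/
noncomputable def quadTail (p q X B C D : ℂ) (i : ℕ) : ℂ :=
  quadWeight p q X B C D i * (ellTheta ((q ^ i) ^ 2) (p ^ 2) *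
    ellTheta (X ^ 2 * (q ^ i) ^ 2 / B) (p ^ 2) * ellTheta (X ^ 2 * (q ^ i) ^ 2 / D ^ 2) (p ^ 2) *
      ellTheta (B * D ^ 2 * (q ^ i) ^ 2) (p ^ 2))

section Ratios

variable {n₁ n₂ n₃ n₄ d₁ d₂ d₃ d₄ a₁ a₂ a₃ a₄ b₁ b₂ b₃ b₄ c e : ℂ}

lemma weight_ratio (h₁ : d₁ ≠ 0) (h₂ : d₂ ≠ 0) (h₃ : d₃ ≠ 0) (h₄ : d₄ ≠ 0) (k₁ : b₁ ≠ 0)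
    (k₂ : b₂ ≠ 0) (k₃ : b₃ ≠ 0) (k₄ : b₄ ≠ 0) :
    n₁ * a₁ * (n₂ * a₂) * (n₃ * a₃ * (n₄ * a₄)) /
        (d₁ * b₁ * (d₂ * b₂) * (d₃ * b₃ * (d₄ * b₄))) * (b₁ * b₂ * b₃ * b₄) =
      n₁ * n₂ * (n₃ * n₄) / (d₁ * d₂ * (d₃ * d₄)) * (a₁ * a₂ * a₃ * a₄) := by
  field_simp

lemma aux_ratio (h₁ : d₁ ≠ 0) (h₂ : d₂ ≠ 0) (h₃ : d₃ ≠ 0) (h₄ : d₄ ≠ 0) (k₃ : b₃ ≠ 0) :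
    c * e * (n₁ * a₁ * (n₂ * a₂) * (n₃ * (n₄ * a₄))) / (d₁ * d₂ * (d₃ * b₃ * d₄)) * b₃ =
      c * e * (n₁ * n₂ * (n₃ * n₄) / (d₁ * d₂ * (d₃ * d₄)) * (a₁ * a₂ * a₄)) := by
  field_simp

end Ratios

/-- A summand of the quadratic series equals `quadAux`, up to constants and a telescoping
difference. The balancing condition on `C * D` is what makes `quad_combine` applicable. -/
lemma quad_step {p q X B C D : ℂ} (hp : ‖p‖ < 1) (hq : q ≠ 0) (hX : X ≠ 0) (hB : B ≠ 0)
    (hD : D ≠ 0) (hCD : C * D = X / (q * B))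
    (h1 : ∀ i : ℕ, ellTheta (q ^ 2 * (q ^ 2) ^ i) (p ^ 2) ≠ 0)
    (h2 : ∀ i : ℕ, ellTheta (X ^ 2 * q ^ 2 / B * (q ^ 2) ^ i) (p ^ 2) ≠ 0)
    (h3 : ∀ i : ℕ, ellTheta (X * q / C * q ^ i) p ≠ 0)
    (h4 : ∀ i : ℕ, ellTheta (X * q / D * q ^ i) p ≠ 0) (i : ℕ) :
    quadConst (p ^ 2) X B D *
        (ellTheta (X ^ 2 * q ^ (4 * i)) (p ^ 2) * quadWeight p q X B C D i * q ^ (2 * i)) =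
      X / (q * B * D) * (ellTheta (q ^ 2 * B) (p ^ 2) * ellTheta (-(q * B * D ^ 2 / X)) p) *
        quadAux p q X B C D i + quadTail p q X B C D (i + 1) - quadTail p q X B C D i := by
  have hp2 := norm_sq_lt_one hp
  have hz : q ^ i ≠ 0 := pow_ne_zero _ hq
  have f1 := ellFactorial_ne_zero h1 i
  have f2 := ellFactorial_ne_zero h2 i
  have f3 := ellFactorial_ne_zero h3 i
  have f4 := ellFactorial_ne_zero h4 i
  have g1 := h1 i
  have g2 := h2 i
  have g3 := h3 i
  have g4 := h4 i
  have hs := quad_split hp2 hX hB hD hz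
  have hc := quad_combine hp hq hX hB hD hz
  unfold quadTail quadConst
  have hC' : C = X / (q * B * D) := by
    field_simp at hCD ⊢
    linear_combination hCD
  have e0 : (q ^ 2) ^ i = (q ^ i) ^ 2 := by ring
  have e1 : q ^ (4 * i) = (q ^ i) ^ 4 := by ring
  have e2 : q ^ (2 * i) = (q ^ i) ^ 2 := by ring
  have e3 : X * q ^ (2 * i + 1) = q * X * (q ^ i) ^ 2 := by ring
  have e4 : q ^ (i + 1) = q * q ^ i := by ring
  rw [e0] at g1 g2
  -- the ratio of consecutive weights
  have hW : quadWeight p q X B C D (i + 1) * (ellTheta (q ^ 2 * (q ^ i) ^ 2) (p ^ 2) *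
      ellTheta (X ^ 2 * q ^ 2 / B * (q ^ i) ^ 2) (p ^ 2) * ellTheta (X * q / C * q ^ i) p *
      ellTheta (X * q / D * q ^ i) p) = quadWeight p q X B C D i *
      (ellTheta (X ^ 2 * (q ^ i) ^ 2) (p ^ 2) * ellTheta (B * (q ^ i) ^ 2) (p ^ 2) *
        ellTheta (C * q ^ i) p * ellTheta (D * q ^ i) p) := by
    unfold quadWeight
    simp only [ellFactorial_succ, e0]
    exact weight_ratio f1 f2 f3 f4 g1 g2 g3 g4
  have hA : quadAux p q X B C D i * ellTheta (X * q / C * q ^ i) p =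
      q ^ i * ellTheta (q * X * (q ^ i) ^ 2) p * (quadWeight p q X B C D i *
      (ellTheta (X ^ 2 * (q ^ i) ^ 2) (p ^ 2) * ellTheta (B * (q ^ i) ^ 2) (p ^ 2) *
        ellTheta (D * q ^ i) p)) := by
    unfold quadAux quadWeight
    simp only [ellFactorial_succ, e0, e3]
    exact aux_ratio f1 f2 f3 f4 g3
  rw [e1, e2, e4]
  generalize q ^ i = z at *
  have k1 : X ^ 2 * (q * z) ^ 2 / D ^ 2 = (X * q / D * z) ^ 2 := by field_simp
  have k2 : D ^ 2 * z ^ 2 = (D * z) ^ 2 := by ring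
  rw [show (q * z) ^ 2 = q ^ 2 * z ^ 2 by ring]
  rw [show X ^ 2 * (q ^ 2 * z ^ 2) / B = X ^ 2 * q ^ 2 / B * z ^ 2 by ring,
    show X ^ 2 * (q ^ 2 * z ^ 2) / D ^ 2 = (X * q / D * z) ^ 2 by field_simp, ellTheta_sq hp,
    show B * D ^ 2 * (q ^ 2 * z ^ 2) = B * D ^ 2 * q ^ 2 * z ^ 2 by ring]
  rw [k2, ellTheta_sq hp] at hs
  rw [show B * q ^ 2 * D * z = X * q / C * z by rw [hC']; field_simp,
    show X * z / (q * B * D) = C * z by rw [hC']; ring,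
    show X * q * z / D = X * q / D * z by ring] at hc
  rw [← hC']
  generalize quadWeight p q X B C D (i + 1) = W' at *
  generalize quadWeight p q X B C D i = W at *
  generalize quadAux p q X B C D i = H at *
  apply mul_right_cancel₀ g3
  linear_combination (W * ellTheta (X * q / C * z) p) * hs -
    (C * (ellTheta (q ^ 2 * B) (p ^ 2) * ellTheta (-(q * B * D ^ 2 / X)) p)) * hA
    - (ellTheta (-(X * q / D * z)) p * ellTheta (B * D ^ 2 * q ^ 2 * z ^ 2) (p ^ 2)) * hW
    + W * ellTheta (X ^ 2 * z ^ 2) (p ^ 2) * ellTheta (B * z ^ 2) (p ^ 2) * ellTheta (D * z) p * hc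

lemma quadWeight_swap (p q X B C D : ℂ) (i : ℕ) :
    quadWeight p q X B C D i = quadWeight p q X B D C i := by
  unfold quadWeight
  ring

lemma quadTail_zero (p q X B C D : ℂ) : quadTail p q X B C D 0 = 0 := by
  simp [quadTail, ellTheta_one]

/-- The very-well-poised series with `M` terms. -/
noncomputable def quadSum (p q X B C D : ℂ) (M : ℕ) : ℂ :=
  ∑ i ∈ Finset.range M, ellTheta (X ^ 2 * q ^ (4 * i)) (p ^ 2) * quadWeight p q X B C D i *
    q ^ (2 * i)

lemma quadSum_eq {p q X B C D : ℂ} (hp : ‖p‖ < 1) (hq : q ≠ 0) (hX : X ≠ 0) (hB : B ≠ 0)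
    (hD : D ≠ 0) (hCD : C * D = X / (q * B))
    (h1 : ∀ i : ℕ, ellTheta (q ^ 2 * (q ^ 2) ^ i) (p ^ 2) ≠ 0)
    (h2 : ∀ i : ℕ, ellTheta (X ^ 2 * q ^ 2 / B * (q ^ 2) ^ i) (p ^ 2) ≠ 0)
    (h3 : ∀ i : ℕ, ellTheta (X * q / C * q ^ i) p ≠ 0)
    (h4 : ∀ i : ℕ, ellTheta (X * q / D * q ^ i) p ≠ 0) (M : ℕ) :
    quadConst (p ^ 2) X B D * quadSum p q X B C D M =
      X / (q * B * D) * (ellTheta (q ^ 2 * B) (p ^ 2) * ellTheta (-(q * B * D ^ 2 / X)) p) *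
        ∑ i ∈ Finset.range M, quadAux p q X B C D i + quadTail p q X B C D M := by
  induction M with
  | zero => simp [quadSum, quadTail_zero]
  | succ M ih =>
    have := quad_step hp hq hX hB hD hCD h1 h2 h3 h4 M
    unfold quadSum at ih ⊢
    rw [Finset.sum_range_succ, Finset.sum_range_succ]
    linear_combination ih + this

/-- The parameters `(C q, D / q)` and `(D, C)` give proportional values of `quadAux`; this links the
series of length `N + 1` to the one of length `N`. -/
lemma quadAux_shift {p q X B C D : ℂ} (hq : q ≠ 0) (i : ℕ)
    (h1 : ellTheta C p ≠ 0) (h2 : ellTheta (X / C) p ≠ 0)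
    (h3 : ∀ i : ℕ, ellTheta (X * q / C * q ^ i) p ≠ 0)
    (h4 : ∀ i : ℕ, ellTheta (X * q / D * q ^ i) p ≠ 0) :
    quadAux p q X B (C * q) (D / q) i * (ellTheta C p * ellTheta (X / C) p) =
      ellTheta (D / q) p * ellTheta (X * q / D) p * quadAux p q X B D C i := by
  have f3 := ellFactorial_ne_zero h3 i
  have f4 := ellFactorial_ne_zero h4 (i + 1)
  rw [ellFactorial_succ_left] at f4
  have e1 : X * q / (C * q) = X / C := by field_simp
  have e2 : X / C * q = X * q / C := by ring
  have e3 : X * q / (D / q) = X * q / D * q := by field_simp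
  have e4 : D / q * q = D := by field_simp
  unfold quadAux
  rw [e1, e3, ellFactorial_succ_left (X / C), ellFactorial_succ_left (X * q / D),
    ellFactorial_succ_left (D / q), ellFactorial_succ_left C, e2, e4]
  have aux : ∀ {c e n g₁ g₂ d f₁ f₂ t₁ t₂ t₃ t₄ : ℂ},
      f₁ ≠ 0 → t₄ * f₂ ≠ 0 → t₁ ≠ 0 → t₂ ≠ 0 →
      c * e * (n * (g₁ * (t₃ * g₂))) / (d * (t₂ * f₁ * f₂)) * (t₁ * t₂) =
        t₃ * t₄ * (c * e * (n * (g₂ * (t₁ * g₁))) / (d * (t₄ * f₂ * f₁))) := by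
    intro c e n g₁ g₂ d f₁ f₂ t₁ t₂ t₃ t₄ k1 k2 k3 k4
    have := left_ne_zero_of_mul k2
    have := right_ne_zero_of_mul k2
    rcases eq_or_ne d 0 with rfl | hd
    · simp
    · field_simp
  exact aux f3 f4 h1 h2

/-- The terminating parameters of the quadratic summation: `D = q ^ (-N)` and
`C = X q ^ (N - 1) / B`. -/
noncomputable def quadTerminating (p q X B : ℂ) (N : ℕ) : ℂ :=
  quadSum p q X B (X * q ^ N / (q * B)) (q ^ N)⁻¹ (N + 1)

lemma quadWeight_eq_zero (p X B C : ℂ) {q : ℂ} (hq : q ≠ 0) {N i : ℕ} (h : N < i) :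
    quadWeight p q X B C (q ^ N)⁻¹ i = 0 := by
  unfold quadWeight
  rw [ellFactorial_eq_zero h (inv_mul_cancel₀ (pow_ne_zero N hq))]
  simp

lemma quadSum_of_lt (p X B C : ℂ) {q : ℂ} (hq : q ≠ 0) {N M : ℕ} (h : N < M) :
    quadSum p q X B C (q ^ N)⁻¹ M = quadSum p q X B C (q ^ N)⁻¹ (N + 1) := by
  unfold quadSum
  refine (Finset.sum_subset (Finset.range_mono h) fun i _ hi => ?_).symm
  rw [quadWeight_eq_zero p X B C hq (by simpa using hi), mul_zero, zero_mul]

/-- Non-resonance conditions under which the quadratic summation is proved: none of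
the theta functions that its proof divides by vanishes. -/
structure QuadGeneric (p q X B : ℂ) : Prop where
  norm_lt : ‖p‖ < 1
  q_ne : q ≠ 0
  X_ne : X ≠ 0
  B_ne : B ≠ 0
  pow_ne : ∀ m : ℕ, ellTheta (q ^ (m + 1)) p ≠ 0
  neg_pow_ne : ∀ m : ℕ, ellTheta (-q ^ (m + 1)) p ≠ 0
  X_pow_ne : ∀ m : ℕ, ellTheta (X * q ^ (m + 1)) p ≠ 0
  X_div_B_ne : ∀ m : ℤ, ellTheta (X * q ^ m / B) p ≠ 0
  neg_X_div_B_ne : ∀ m : ℤ, ellTheta (-(X * q ^ m / B)) p ≠ 0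
  B_zpow_ne : ∀ m : ℤ, ellTheta (B * q ^ m) p ≠ 0
  X_sq_div_B_ne : ∀ m : ℤ, ellTheta (X ^ 2 * q ^ m / B) (p ^ 2) ≠ 0
  B_zpow_ne' : ∀ m : ℤ, ellTheta (B * q ^ m) (p ^ 2) ≠ 0

namespace QuadGeneric

variable {p q X B : ℂ}

lemma sq_ne (h : QuadGeneric p q X B) (i : ℕ) : ellTheta (q ^ 2 * (q ^ 2) ^ i) (p ^ 2) ≠ 0 := by
  rw [show q ^ 2 * (q ^ 2) ^ i = (q ^ (i + 1)) ^ 2 by ring, ellTheta_sq h.norm_lt]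
  exact mul_ne_zero (h.pow_ne i) (h.neg_pow_ne i)

lemma X_sq_ne (h : QuadGeneric p q X B) (i : ℕ) :
    ellTheta (X ^ 2 * q ^ 2 / B * (q ^ 2) ^ i) (p ^ 2) ≠ 0 := by
  have := h.X_sq_div_B_ne ((2 + 2 * i : ℕ) : ℤ)
  rw [zpow_natCast] at this
  convert this using 2
  ring

lemma den_C_ne (h : QuadGeneric p q X B) (N i : ℕ) :
    ellTheta (X * q / (X * q ^ N / (q * B)) * q ^ i) p ≠ 0 := by
  have := h.B_zpow_ne ((i + 2 : ℕ) - N)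
  have hq := h.q_ne
  have hX := h.X_ne
  have hB := h.B_ne
  rw [zpow_sub₀ hq, zpow_natCast, zpow_natCast] at this
  convert this using 2
  field_simp; ring

lemma den_D_ne (h : QuadGeneric p q X B) (N i : ℕ) :
    ellTheta (X * q / (q ^ N)⁻¹ * q ^ i) p ≠ 0 := by
  have := h.X_pow_ne (N + i)
  convert this using 2
  rw [div_inv_eq_mul]
  ring

lemma C_ne (h : QuadGeneric p q X B) (N : ℕ) : ellTheta (X * q ^ N / (q * B)) p ≠ 0 := by
  have := h.X_div_B_ne (N - 1)
  have hq := h.q_ne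
  have hB := h.B_ne
  rw [zpow_sub_one₀ hq, zpow_natCast] at this
  convert this using 2
  field_simp

lemma X_div_C_ne (h : QuadGeneric p q X B) (N : ℕ) :
    ellTheta (X / (X * q ^ N / (q * B))) p ≠ 0 := by
  have := h.B_zpow_ne (1 - N)
  have hq := h.q_ne
  have hX := h.X_ne
  have hB := h.B_ne
  rw [zpow_sub₀ hq, zpow_natCast, zpow_one] at this
  convert this using 2
  field_simp

end QuadGeneric

/-- The first-order recurrence in the length of the terminating quadratic series. -/
lemma quadTerminating_succ {p q X B : ℂ} (h : QuadGeneric p q X B) (N : ℕ) :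
    quadTerminating p q X B (N + 1) * (ellTheta (-(X * q ^ (2 * N) / (q * B))) p *
        ellTheta (-(q * q ^ N)) p * ellTheta (q ^ N / (q * B)) p *
        ellTheta (X ^ 2 * q ^ 2 * q ^ (2 * N) / B) (p ^ 2)) =
      quadTerminating p q X B N * (q * (ellTheta (-(X * q * q ^ (2 * N) / B)) p *
        ellTheta (-(X * q ^ N / (q * B))) p * ellTheta (X * q * q ^ N) p *
        ellTheta (q ^ (2 * N) / (q ^ 2 * B)) (p ^ 2))) := by
  have hp := h.norm_lt
  have hp2 := norm_sq_lt_one hp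
  have hq := h.q_ne
  have hX := h.X_ne
  have hB := h.B_ne
  have hr : q ^ N ≠ 0 := pow_ne_zero _ hq
  -- both series reduce to the same auxiliary sum
  have s0 := quadSum_eq (C := (q ^ N)⁻¹) (D := X * q ^ N / (q * B)) hp hq hX hB (by positivity)
    (by field_simp) h.sq_ne h.X_sq_ne (h.den_D_ne N) (h.den_C_ne N) (N + 2)
  have s1 := quadSum_eq (C := X * q ^ (N + 1) / (q * B)) (D := (q ^ (N + 1))⁻¹) hp hq hX hB
    (by positivity) (by field_simp) h.sq_ne h.X_sq_ne (h.den_C_ne (N + 1)) (h.den_D_ne (N + 1))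
    (N + 2)
  have hsw : quadSum p q X B (q ^ N)⁻¹ (X * q ^ N / (q * B)) (N + 2) =
      quadTerminating p q X B N := by
    rw [quadTerminating, ← quadSum_of_lt p X B _ hq (by omega : N < N + 2)]
    exact Finset.sum_congr rfl fun i _ => by rw [quadWeight_swap]
  have t0 : quadTail p q X B (q ^ N)⁻¹ (X * q ^ N / (q * B)) (N + 2) = 0 := by
    rw [quadTail, quadWeight_swap, quadWeight_eq_zero p X B _ hq (by omega), zero_mul]
  have t1 : quadTail p q X B (X * q ^ (N + 1) / (q * B)) (q ^ (N + 1))⁻¹ (N + 2) = 0 := by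
    rw [quadTail, quadWeight_eq_zero p X B _ hq (by omega), zero_mul]
  have sh : (∑ i ∈ Finset.range (N + 2),
      quadAux p q X B (X * q ^ (N + 1) / (q * B)) (q ^ (N + 1))⁻¹ i) *
      (ellTheta (X * q ^ N / (q * B)) p * ellTheta (X / (X * q ^ N / (q * B))) p) =
      ellTheta ((q ^ (N + 1))⁻¹) p * ellTheta (X * q / (q ^ N)⁻¹) p *
      ∑ i ∈ Finset.range (N + 2), quadAux p q X B (q ^ N)⁻¹ (X * q ^ N / (q * B)) i := by
    rw [Finset.sum_mul, Finset.mul_sum]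
    refine Finset.sum_congr rfl fun i _ => ?_
    have := quadAux_shift (p := p) (B := B) hq i (h.C_ne N) (h.X_div_C_ne N) (h.den_C_ne N)
      (h.den_D_ne N)
    rw [show X * q ^ N / (q * B) * q = X * q ^ (N + 1) / (q * B) by ring,
      show (q ^ N)⁻¹ / q = (q ^ (N + 1))⁻¹ by field_simp; ring] at this
    exact this
  rw [hsw, t0, add_zero] at s0
  rw [t1, add_zero, show quadSum p q X B (X * q ^ (N + 1) / (q * B)) (q ^ (N + 1))⁻¹ (N + 2) =
    quadTerminating p q X B (N + 1) from rfl] at s1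
  -- arguments are brought to a common form by inversion
  have c1 := h.C_ne N
  have c2 := h.X_div_C_ne N
  have c3 := h.pow_ne N
  have c4 : ellTheta B⁻¹ (p ^ 2) ≠ 0 := by
    have := h.B_zpow_ne' 0
    rw [ellTheta_inv hp2 hB]
    simpa [hB] using this
  have c5 : ellTheta (q ^ 2 * B) (p ^ 2) ≠ 0 := by
    have := h.B_zpow_ne' 2
    rw [mul_comm]
    exact_mod_cast this
  unfold quadConst at s0 s1
  have i1 := ellTheta_inv (x := X * q ^ N / (q * B)) hp (by positivity)
  have i2 := ellTheta_inv (x := -(X * q ^ N / (q * B))) hp (neg_ne_zero.mpr (by positivity))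
  have i3 := ellTheta_inv (x := q ^ (N + 1)) hp (by positivity)
  have i4 := ellTheta_inv (x := q ^ N / (q * B)) hp (by positivity)
  have i5 := ellTheta_inv (x := q ^ (2 * N) / (q ^ 2 * B)) hp2 (by positivity)
  have i6 := ellTheta_inv (x := -(X * q * q ^ (2 * N) / B)) hp (neg_ne_zero.mpr (by positivity))
  rw [show ((X * q ^ N / (q * B)) ^ 2)⁻¹ = ((X * q ^ N / (q * B))⁻¹) ^ 2 by rw [inv_pow],
    ellTheta_sq hp, ← inv_neg, i1, i2,
    show X ^ 2 / (B * (X * q ^ N / (q * B)) ^ 2) = (q ^ (2 * N) / (q ^ 2 * B))⁻¹ by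
      field_simp; ring,
    i5, show X / (q * B * (X * q ^ N / (q * B))) = (q ^ N)⁻¹ by field_simp,
    show q * B * (X * q ^ N / (q * B)) ^ 2 / X = X * q ^ (2 * N) / (q * B) by
      field_simp; ring] at s0
  rw [show (((q ^ (N + 1))⁻¹) ^ 2)⁻¹ = (q ^ (N + 1)) ^ 2 by rw [inv_pow, inv_inv],
    ellTheta_sq hp, show -(q * B * (q ^ (N + 1))⁻¹ ^ 2 / X) = (-(X * q * q ^ (2 * N) / B))⁻¹ by
      rw [inv_neg]; field_simp; ring, i6,
    show X ^ 2 / (B * (q ^ (N + 1))⁻¹ ^ 2) = X ^ 2 * q ^ 2 * q ^ (2 * N) / B by field_simp; ring]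
    at s1
  rw [i3, show X / (X * q ^ N / (q * B)) = (q ^ N / (q * B))⁻¹ by field_simp, i4,
    show X * q / (q ^ N)⁻¹ = X * q * q ^ N by rw [div_inv_eq_mul]] at sh
  rw [show q * q ^ N = q ^ (N + 1) by ring]
  have e2 : q ^ (2 * N) = (q ^ N) ^ 2 := by ring
  have c2' : ellTheta (q ^ N / (q * B)) p ≠ 0 := by
    rw [show X / (X * q ^ N / (q * B)) = (q ^ N / (q * B))⁻¹ by field_simp, i4] at c2
    exact right_ne_zero_of_mul c2
  clear i1 i2 i3 i4 i5 i6 hsw t0 t1 h c2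
  generalize ellTheta (q ^ N / (q * B)) p = θ1 at *
  generalize ellTheta (q ^ (2 * N) / (q ^ 2 * B)) (p ^ 2) = θ2 at *
  generalize ellTheta (-(X * q * q ^ (2 * N) / B)) p = θ3 at *
  generalize ellTheta (-(X * q ^ N / (q * B))) p = θ4 at *
  generalize ellTheta (X * q ^ N / (q * B)) p = θ5 at *
  generalize ellTheta (-(X * q ^ (2 * N) / (q * B))) p = θ6 at *
  generalize ellTheta (q ^ (N + 1)) p = θ7 at *
  generalize ellTheta (-q ^ (N + 1)) p = θ8 at *
  generalize ellTheta (X ^ 2 * q ^ 2 * q ^ (2 * N) / B) (p ^ 2) = θ9 at *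
  generalize ellTheta B⁻¹ (p ^ 2) = θ10 at *
  generalize ellTheta (q ^ 2 * B) (p ^ 2) = θ11 at *
  generalize ellTheta (X * q * q ^ N) p = θ12 at *
  generalize quadTerminating p q X B N = T at *
  generalize quadTerminating p q X B (N + 1) = T' at *
  generalize ∑ i ∈ Finset.range (N + 2), quadAux p q X B (q ^ N)⁻¹ (X * q ^ N / (q * B)) i = S at *
  generalize ∑ i ∈ Finset.range (N + 2),
    quadAux p q X B (X * q ^ (N + 1) / (q * B)) (q ^ (N + 1))⁻¹ i = S' at *
  rw [pow_succ q N] at s1 sh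
  rw [e2] at s0 s1
  generalize q ^ N = r at *
  field_simp at s0 s1 sh
  have hne : B * θ10 * θ7 * (B * q ^ 2 * θ5) ≠ 0 := by positivity
  apply mul_left_cancel₀ hne
  linear_combination (B * q ^ 2 * θ5 * θ6 * θ1) * s1 - (θ6 * θ11 * q * r * θ3) * sh -
    (q * θ3 * θ7 * θ12) * s0

/-- Closed form of the terminating quadratic summation. -/
lemma quadTerminating_closed {p q X B : ℂ} (h : QuadGeneric p q X B) (N : ℕ) :
    quadTerminating p q X B N * (ellTheta (-(X / (q * B))) p * (ellFactorial (-q) q p N *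
        ellFactorial (1 / (q * B)) q p N) *
        ellFactorial (X ^ 2 * q ^ 2 / B) (q ^ 2) (p ^ 2) N) =
      q ^ N * ellTheta (X ^ 2) (p ^ 2) * (ellTheta (-(X * q ^ (2 * N) / (q * B))) p *
        (ellFactorial (-(X / (q * B))) q p N * ellFactorial (X * q) q p N) *
        ellFactorial (1 / (q ^ 2 * B)) (q ^ 2) (p ^ 2) N) := by
  induction N with
  | zero => simp [quadTerminating, quadSum, quadWeight, ellFactorial_zero, mul_comm]
  | succ N ih =>
    have hq := h.q_ne
    have hs := quadTerminating_succ h N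
    have hne : ellTheta (-(X * q ^ (2 * N) / (q * B))) p ≠ 0 := by
      have := h.neg_X_div_B_ne ((2 * N : ℕ) - 1)
      rw [zpow_sub_one₀ hq, zpow_natCast] at this
      convert this using 2
      have hB := h.B_ne
      field_simp
    simp only [ellFactorial_succ]
    rw [show X * q ^ (2 * (N + 1)) / (q * B) = X * q * q ^ (2 * N) / B by
        have hB := h.B_ne
        field_simp; ring,
      show -q * q ^ N = -(q * q ^ N) by ring, show 1 / (q * B) * q ^ N = q ^ N / (q * B) by ring,
      show X ^ 2 * q ^ 2 / B * (q ^ 2) ^ N = X ^ 2 * q ^ 2 * q ^ (2 * N) / B by ring,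
      show -(X / (q * B)) * q ^ N = -(X * q ^ N / (q * B)) by ring,
      show 1 / (q ^ 2 * B) * (q ^ 2) ^ N = q ^ (2 * N) / (q ^ 2 * B) by ring]
    apply mul_right_cancel₀ hne
    linear_combination (ellTheta (-(X / (q * B))) p * (ellFactorial (-q) q p N *
        ellFactorial (1 / (q * B)) q p N) *
        ellFactorial (X ^ 2 * q ^ 2 / B) (q ^ 2) (p ^ 2) N) * hs +
      (q * (ellTheta (-(X * q * q ^ (2 * N) / B)) p *
        ellTheta (-(X * q ^ N / (q * B))) p * ellTheta (X * q * q ^ N) p *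
        ellTheta (q ^ (2 * N) / (q ^ 2 * B)) (p ^ 2))) * ih

/-! ### A very-well-poised expansion -/

/-- The summand of the very-well-poised expansion, without its very-well-poised part
`θ(a q^{4j}; p)`. The series terminates when `κ` is an odd power of `q`. -/
noncomputable def expWeight (p q a b κ : ℂ) (j : ℕ) : ℂ :=
  (-a) ^ j * (ellFactorial (a ^ 2) (q ^ 4) p j * (ellFactorial (κ * q) (q ^ 2) p j *
    ellFactorial (q / κ) (q ^ 2) p j) * (ellFactorial (a * q / b) (q ^ 2) p j *
    ellFactorial (b * q / a) (q ^ 2) p j)) /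
  (ellFactorial (q ^ 4) (q ^ 4) p j * (ellFactorial (a * q * κ) (q ^ 2) p j *
    ellFactorial (a * q / κ) (q ^ 2) p j) * (ellFactorial (b * q) (q ^ 2) p j *
    ellFactorial (a ^ 2 * q / b) (q ^ 2) p j))

/-- The very-well-poised series with `M` terms. -/
noncomputable def expSum (p q a b κ : ℂ) (M : ℕ) : ℂ :=
  ∑ j ∈ Finset.range M, ellTheta (a * ((q ^ 2) ^ j) ^ 2) p * expWeight p q a b κ j

/-- The first half of the split very-well-poised summand. -/
noncomputable def expHead (p q a b κ : ℂ) (j : ℕ) : ℂ :=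
  expWeight p q a b κ j * (ellTheta (a * κ / (q ^ 3 * (q ^ 2) ^ j)) p *
    ellTheta (a * κ * (q ^ 2) ^ j / q) p *
    (ellTheta (b * (q ^ 2) ^ j / q) p * ellTheta (a ^ 2 * (q ^ 2) ^ j / (b * q)) p))

/-- The second half of the split very-well-poised summand. -/
noncomputable def expTail (p q a b κ : ℂ) (j : ℕ) : ℂ :=
  -(a / q ^ 2) * (expWeight p q a b κ j * (ellTheta (κ / (q * (q ^ 2) ^ j)) p *
    ellTheta (a ^ 2 * κ * (q ^ 2) ^ j / q ^ 3) p *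
    (ellTheta (b * q / a * (q ^ 2) ^ j) p * ellTheta (a * q / b * (q ^ 2) ^ j) p)))

/-- The product obtained by recombining `expHead` at `j + 1` with `expTail` at `j`. -/
noncomputable def expAux (p q a b κ : ℂ) (j : ℕ) : ℂ :=
  expWeight p q a b κ j * (ellTheta (b * q / a * (q ^ 2) ^ j) p *
    ellTheta (a * q / b * (q ^ 2) ^ j) p * (ellTheta (q / κ * (q ^ 2) ^ j) p *
    ellTheta (κ / (q ^ 3 * (q ^ 2) ^ j)) p) * (ellTheta (a * κ * (q ^ 2) ^ j / q) p *
    ellTheta (a * q ^ 2 * ((q ^ 2) ^ j) ^ 2) p)) /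
  (ellTheta (q ^ 4 * ((q ^ 2) ^ j) ^ 2) p * ellTheta (a * q / κ * (q ^ 2) ^ j) p)

/-- The addition formula splits the very-well-poised factor, multiplied by a product free of the
summation index, into two parts. -/
lemma exp_split {p q a b κ : ℂ} (hp : ‖p‖ < 1) (hq : q ≠ 0) (ha : a ≠ 0) (hb : b ≠ 0)
    (hκ : κ ≠ 0) (j : ℕ) :
    ellTheta (a / q ^ 2) p * (ellTheta (b * κ / q ^ 2) p * ellTheta (a ^ 2 * κ / (b * q ^ 2)) p) *
        (ellTheta (a * ((q ^ 2) ^ j) ^ 2) p * expWeight p q a b κ j) =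
      expHead p q a b κ j + expTail p q a b κ j := by
  unfold expHead expTail
  have hz : (q ^ 2) ^ j ≠ 0 := by positivity
  generalize (q ^ 2) ^ j = z at *
  have h := ellTheta_addition (A := a * κ * z / q) (B := b * z / q) (C := a ^ 2 * z / (b * q))
    (w := a * z ^ 2) hp (by positivity) (by positivity) (by positivity) (by positivity)
  rw [show a * κ * z / q * (b * z / q) * (a ^ 2 * z / (b * q)) / (a * z ^ 2) ^ 2 =
      a * κ / (q ^ 3 * z) by field_simp,
    show a * κ * z / q * (b * z / q) / (a * z ^ 2) = b * κ / q ^ 2 by field_simp,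
    show a * κ * z / q * (a ^ 2 * z / (b * q)) / (a * z ^ 2) = a ^ 2 * κ / (b * q ^ 2) by
      field_simp,
    show b * z / q * (a ^ 2 * z / (b * q)) / (a * z ^ 2) = a / q ^ 2 by field_simp,
    show a * z ^ 2 / (b * z / q) = a * q / b * z by field_simp,
    show a * κ * z / q / (a * z ^ 2) = κ / (q * z) by field_simp,
    show a * κ * z / q * (b * z / q) * (a ^ 2 * z / (b * q)) / (a * z ^ 2) =
      a ^ 2 * κ * z / q ^ 3 by field_simp,
    show a * z ^ 2 / (a ^ 2 * z / (b * q)) = b * q / a * z by field_simp] at h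
  linear_combination -expWeight p q a b κ j * h

/-- The addition formula behind `exp_step`. -/
lemma exp_combine {p q a κ z : ℂ} (hp : ‖p‖ < 1) (hq : q ≠ 0) (ha : a ≠ 0) (hκ : κ ≠ 0)
    (hz : z ≠ 0) :
    ellTheta (a / q ^ 2) p * (ellTheta (a ^ 2 * z ^ 2) p * ellTheta (κ * q * z) p *
        ellTheta (q / κ * z) p * ellTheta (a * κ / (q ^ 5 * z)) p +
      1 / q ^ 2 * (ellTheta (κ / (q * z)) p * ellTheta (a ^ 2 * κ * z / q ^ 3) p *
        ellTheta (q ^ 4 * z ^ 2) p * ellTheta (a * q / κ * z) p)) =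
    ellTheta (a ^ 2 / q ^ 4) p * (ellTheta (q / κ * z) p * ellTheta (κ / (q ^ 3 * z)) p *
      (ellTheta (a * κ * z / q) p * ellTheta (a * q ^ 2 * z ^ 2) p)) := by
  have h := ellTheta_addition (A := a ^ 2 * z ^ 2) (B := κ * q * z) (C := a * κ / (q ^ 5 * z))
    (w := a * κ * z / q) hp (by positivity) (by positivity) (by positivity) (by positivity)
  have hi := ellTheta_inv (x := q / κ * z) hp (by positivity)
  rw [show (q / κ * z)⁻¹ = κ / (q * z) by field_simp] at hi
  rw [show a ^ 2 * z ^ 2 * (κ * q * z) * (a * κ / (q ^ 5 * z)) / (a * κ * z / q) ^ 2 =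
      a / q ^ 2 by field_simp,
    show a ^ 2 * z ^ 2 * (κ * q * z) / (a * κ * z / q) = a * q ^ 2 * z ^ 2 by field_simp,
    show a ^ 2 * z ^ 2 * (a * κ / (q ^ 5 * z)) / (a * κ * z / q) = a ^ 2 / q ^ 4 by field_simp,
    show κ * q * z * (a * κ / (q ^ 5 * z)) / (a * κ * z / q) = κ / (q ^ 3 * z) by field_simp,
    show a * κ * z / q / (κ * q * z) = a / q ^ 2 by field_simp,
    show a ^ 2 * z ^ 2 / (a * κ * z / q) = a * q / κ * z by field_simp,
    show a ^ 2 * z ^ 2 * (κ * q * z) * (a * κ / (q ^ 5 * z)) / (a * κ * z / q) =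
      a ^ 2 * κ * z / q ^ 3 by field_simp,
    show a * κ * z / q / (a * κ / (q ^ 5 * z)) = q ^ 4 * z ^ 2 by field_simp] at h
  rw [hi]
  linear_combination (ellTheta (q / κ * z) p) * h

/-- Non-vanishing of the denominators of the very-well-poised expansion. -/
structure ExpGeneric (p q a b κ : ℂ) : Prop where
  norm_lt : ‖p‖ < 1
  q_ne : q ≠ 0
  a_ne : a ≠ 0
  b_ne : b ≠ 0
  κ_ne : κ ≠ 0
  den_q : ∀ j : ℕ, ellTheta (q ^ 4 * (q ^ 4) ^ j) p ≠ 0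
  den_aκ : ∀ j : ℕ, ellTheta (a * q * κ * (q ^ 2) ^ j) p ≠ 0
  den_a_div : ∀ j : ℕ, ellTheta (a * q / κ * (q ^ 2) ^ j) p ≠ 0
  den_b : ∀ j : ℕ, ellTheta (b * q * (q ^ 2) ^ j) p ≠ 0
  den_a_sq : ∀ j : ℕ, ellTheta (a ^ 2 * q / b * (q ^ 2) ^ j) p ≠ 0

lemma exp_ratio {c d n₁ n₂ n₃ n₄ n₅ d₁ d₂ d₃ d₄ d₅ a₁ a₂ a₃ a₄ a₅ b₁ b₂ b₃ b₄ b₅ : ℂ}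
    (h₁ : d₁ ≠ 0) (h₂ : d₂ ≠ 0) (h₃ : d₃ ≠ 0) (h₄ : d₄ ≠ 0) (h₅ : d₅ ≠ 0) (k₁ : b₁ ≠ 0)
    (k₂ : b₂ ≠ 0) (k₃ : b₃ ≠ 0) (k₄ : b₄ ≠ 0) (k₅ : b₅ ≠ 0) :
    c * d * (n₁ * a₁ * (n₂ * a₂ * (n₃ * a₃)) * (n₄ * a₄ * (n₅ * a₅))) /
        (d₁ * b₁ * (d₂ * b₂ * (d₃ * b₃)) * (d₄ * b₄ * (d₅ * b₅))) *
        (b₁ * (b₂ * b₃) * (b₄ * b₅)) =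
      c * (n₁ * (n₂ * n₃) * (n₄ * n₅)) / (d₁ * (d₂ * d₃) * (d₄ * d₅)) *
        (d * (a₁ * (a₂ * a₃) * (a₄ * a₅))) := by
  rw [div_mul_eq_mul_div, div_mul_eq_mul_div, div_eq_div_iff (by positivity) (by positivity)]
  ring

lemma expWeight_succ {p q a b κ : ℂ} (h : ExpGeneric p q a b κ) (j : ℕ) :
    expWeight p q a b κ (j + 1) * (ellTheta (q ^ 4 * ((q ^ 2) ^ j) ^ 2) p *
        (ellTheta (a * q * κ * (q ^ 2) ^ j) p * ellTheta (a * q / κ * (q ^ 2) ^ j) p) *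
        (ellTheta (b * q * (q ^ 2) ^ j) p * ellTheta (a ^ 2 * q / b * (q ^ 2) ^ j) p)) =
      expWeight p q a b κ j * (-a * (ellTheta (a ^ 2 * ((q ^ 2) ^ j) ^ 2) p *
        (ellTheta (κ * q * (q ^ 2) ^ j) p * ellTheta (q / κ * (q ^ 2) ^ j) p) *
        (ellTheta (a * q / b * (q ^ 2) ^ j) p * ellTheta (b * q / a * (q ^ 2) ^ j) p))) := by
  rw [show ((q ^ 2) ^ j) ^ 2 = (q ^ 4) ^ j by ring]
  unfold expWeight
  simp only [ellFactorial_succ, pow_succ (-a)]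
  exact exp_ratio (ellFactorial_ne_zero h.den_q j) (ellFactorial_ne_zero h.den_aκ j)
    (ellFactorial_ne_zero h.den_a_div j) (ellFactorial_ne_zero h.den_b j)
    (ellFactorial_ne_zero h.den_a_sq j) (h.den_q j) (h.den_aκ j) (h.den_a_div j) (h.den_b j)
    (h.den_a_sq j)

lemma exp_step {p q a b κ : ℂ} (h : ExpGeneric p q a b κ) (j : ℕ) :
    ellTheta (a / q ^ 2) p * (expHead p q a b κ (j + 1) + expTail p q a b κ j) =
      -a * ellTheta (a ^ 2 / q ^ 4) p * expAux p q a b κ j := by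
  have hq := h.q_ne
  have hw := expWeight_succ h j
  have hc := exp_combine h.norm_lt hq h.a_ne h.κ_ne (z := (q ^ 2) ^ j) (by positivity)
  have d1 := h.den_q j
  have d2 := h.den_aκ j
  have d3 := h.den_a_div j
  have d4 := h.den_b j
  have d5 := h.den_a_sq j
  rw [show (q ^ 4) ^ j = ((q ^ 2) ^ j) ^ 2 by ring] at d1
  unfold expHead expTail expAux
  rw [pow_succ (q ^ 2) j]
  have hz : (q ^ 2) ^ j ≠ 0 := by positivity
  have hb := h.b_ne
  have hκ := h.κ_ne
  generalize (q ^ 2) ^ j = z at *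
  rw [show a * κ / (q ^ 3 * (z * q ^ 2)) = a * κ / (q ^ 5 * z) by field_simp,
    show a * κ * (z * q ^ 2) / q = a * q * κ * z by field_simp,
    show b * (z * q ^ 2) / q = b * q * z by field_simp,
    show a ^ 2 * (z * q ^ 2) / (b * q) = a ^ 2 * q / b * z by field_simp]
  rw [mul_div_assoc', eq_div_iff (mul_ne_zero d1 d3)]
  linear_combination (ellTheta (a / q ^ 2) p * ellTheta (a * κ / (q ^ 5 * z)) p) * hw -
    a * expWeight p q a b κ j * (ellTheta (b * q / a * z) p * ellTheta (a * q / b * z) p) * hc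

/-- Reduction of the very-well-poised series to the sum of `expAux`. -/
lemma expSum_eq {p q a b κ : ℂ} (h : ExpGeneric p q a b κ) (M : ℕ) :
    ellTheta (a / q ^ 2) p ^ 2 *
        (ellTheta (b * κ / q ^ 2) p * ellTheta (a ^ 2 * κ / (b * q ^ 2)) p) *
        expSum p q a b κ (M + 1) =
      ellTheta (a / q ^ 2) p * expHead p q a b κ 0 - a * ellTheta (a ^ 2 / q ^ 4) p *
        ∑ j ∈ Finset.range M, expAux p q a b κ j +
      ellTheta (a / q ^ 2) p * expTail p q a b κ M := by
  have hs := exp_split h.norm_lt h.q_ne h.a_ne h.b_ne h.κ_ne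
  unfold expSum
  induction M with
  | zero =>
    rw [Finset.sum_range_one, Finset.sum_range_zero]
    linear_combination ellTheta (a / q ^ 2) p * hs 0
  | succ M ih =>
    rw [Finset.sum_range_succ, Finset.sum_range_succ (expAux p q a b κ)]
    linear_combination ih + ellTheta (a / q ^ 2) p * hs (M + 1) + exp_step h M

/-- Explicit form of `expAux`; the shifted factorials containing `κ` are paired so that
`κ ↦ q ^ 4 / κ` exchanges the members of each pair. -/
lemma expAux_mul {p q a b κ : ℂ} (h : ExpGeneric p q a b κ) (j : ℕ) :
    expAux p q a b κ j * (ellFactorial (a * κ / q ^ 3) (q ^ 2) p (j + 1) *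
        ellFactorial (a * q / κ) (q ^ 2) p (j + 1)) =
      (-a) ^ j * (ellFactorial (a ^ 2) (q ^ 4) p j *
        (ellFactorial (a * q / b) (q ^ 2) p (j + 1) *
          ellFactorial (b * q / a) (q ^ 2) p (j + 1)) *
        ellTheta (a * q ^ 2 * ((q ^ 2) ^ j) ^ 2) p) /
      (ellFactorial (q ^ 4) (q ^ 4) p (j + 1) * (ellFactorial (b * q) (q ^ 2) p j *
        ellFactorial (a ^ 2 * q / b) (q ^ 2) p j) * (q ^ 2 * (q ^ 2) ^ j)) *
      (ellFactorial (q ^ 3 / κ) (q ^ 2) p (j + 1) * ellFactorial (κ / q) (q ^ 2) p (j + 1)) *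
      (ellTheta (a * κ / q ^ 3) p * ellTheta (a * κ / q) p) := by
  have hq := h.q_ne
  have ha := h.a_ne
  have hκ := h.κ_ne
  have hp := h.norm_lt
  have hz : (q ^ 2) ^ j ≠ 0 := by positivity
  have i1 := ellTheta_inv (x := q ^ 3 / κ * (q ^ 2) ^ j) hp (by positivity)
  rw [show (q ^ 3 / κ * (q ^ 2) ^ j)⁻¹ = κ / (q ^ 3 * (q ^ 2) ^ j) by field_simp] at i1
  have i2 := ellTheta_inv (x := κ / q) hp (by positivity)
  rw [show (κ / q)⁻¹ = q / κ by field_simp] at i2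
  have j1 := ellFactorial_succ_left (q / κ) (q ^ 2) p (j + 1)
  rw [ellFactorial_succ _ _ _ (j + 1), i2, show q / κ * q ^ 2 = q ^ 3 / κ by ring,
    show q / κ * (q ^ 2) ^ (j + 1) = q ^ 3 / κ * (q ^ 2) ^ j by ring] at j1
  have j2 := ellFactorial_succ_left (κ / q) (q ^ 2) p j
  rw [show κ / q * q ^ 2 = κ * q by field_simp] at j2
  have j3 := ellFactorial_succ_left (a * κ / q ^ 3) (q ^ 2) p (j + 1)
  rw [ellFactorial_succ _ _ _ (j + 1), show a * κ / q ^ 3 * q ^ 2 = a * κ / q by field_simp,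
    show a * κ / q ^ 3 * (q ^ 2) ^ (j + 1) = a * κ * (q ^ 2) ^ j / q by field_simp; ring,
    ellFactorial_succ_left (a * κ / q), show a * κ / q * q ^ 2 = a * q * κ by field_simp] at j3
  have f1 := ellFactorial_ne_zero h.den_q (j + 1)
  have f2 := ellFactorial_ne_zero h.den_aκ j
  have f3 := ellFactorial_ne_zero h.den_a_div (j + 1)
  have f4 := ellFactorial_ne_zero h.den_b j
  have f5 := ellFactorial_ne_zero h.den_a_sq j
  unfold expAux expWeight
  rw [i1]
  rw [ellFactorial_succ] at f1 f3
  rw [ellFactorial_succ (q / κ)] at j1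
  rw [ellFactorial_succ (a * q / κ), ellFactorial_succ (a * q / b), ellFactorial_succ (b * q / a),
    ellFactorial_succ (q ^ 4)]
  have g1 := left_ne_zero_of_mul f1
  have g2 := right_ne_zero_of_mul f1
  have g3 := left_ne_zero_of_mul f3
  have g4 := right_ne_zero_of_mul f3
  have e4 : (q ^ 4) ^ j = ((q ^ 2) ^ j) ^ 2 := by ring
  rw [e4] at g2 ⊢
  clear f1 f3 i1 i2 h
  generalize (q ^ 2) ^ j = z at *
  generalize ellTheta (q ^ 3 / κ * z) p = t₁ at *
  generalize ellTheta (κ / q) p = t₂ at *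
  generalize ellTheta (a * κ / q ^ 3) p = t₃ at *
  generalize ellTheta (a * κ / q) p = t₄ at *
  generalize ellTheta (a * κ * z / q) p = t₅ at *
  generalize ellTheta (q / κ * z) p = t₆ at *
  generalize ellTheta (a * q / κ * z) p = t₇ at *
  generalize ellTheta (q ^ 4 * z ^ 2) p = t₈ at *
  generalize ellTheta (a * q / b * z) p = t₉ at *
  generalize ellTheta (b * q / a * z) p = t₁₀ at *
  generalize ellTheta (a * q ^ 2 * z ^ 2) p = t₁₁ at *
  generalize ellFactorial (q / κ) (q ^ 2) p j = s₁ at *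
  generalize ellFactorial (q ^ 3 / κ) (q ^ 2) p (j + 1) = s₂ at *
  generalize ellFactorial (κ / q) (q ^ 2) p (j + 1) = s₃ at *
  generalize ellFactorial (κ * q) (q ^ 2) p j = s₄ at *
  generalize ellFactorial (a * κ / q ^ 3) (q ^ 2) p (j + 1) = s₅ at *
  generalize ellFactorial (a * q * κ) (q ^ 2) p j = s₆ at *
  generalize ellFactorial (a * q / κ) (q ^ 2) p j = s₇ at *
  generalize ellFactorial (q ^ 4) (q ^ 4) p j = s₈ at *
  generalize ellFactorial (b * q) (q ^ 2) p j = s₉ at *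
  generalize ellFactorial (a ^ 2 * q / b) (q ^ 2) p j = s₁₀ at *
  generalize ellFactorial (a ^ 2) (q ^ 4) p j = s₁₁ at *
  generalize ellFactorial (a * q / b) (q ^ 2) p j = s₁₂ at *
  generalize ellFactorial (b * q / a) (q ^ 2) p j = s₁₃ at *
  subst j2
  field_simp at j1 ⊢
  linear_combination -((-a) ^ j * s₁₁ * s₄ * s₁₂ * s₁₃ * t₁₀ * t₉ * t₅ * t₁₁ * s₅) * j1 +
    (q * t₂ * s₂ * (-a) ^ j * s₁₁ * s₄ * s₁₂ * s₁₃ * t₁₀ * t₉ * t₁₁) * j3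

/-- Up to the boundary value `expHead 0`, the auxiliary product is invariant under
`κ ↦ q ^ 4 / κ`. -/
lemma expAux_symm {p q a b κ : ℂ} (h : ExpGeneric p q a b κ) (h' : ExpGeneric p q a b (q ^ 4 / κ))
    (j : ℕ) :
    expAux p q a b κ j * expHead p q a b (q ^ 4 / κ) 0 =
      expAux p q a b (q ^ 4 / κ) j * expHead p q a b κ 0 := by
  have hq := h.q_ne
  have hκ := h.κ_ne
  have e1 := expAux_mul h j
  have e2 := expAux_mul h' j
  have d1 := ellFactorial_ne_zero h.den_a_div (j + 1)
  have d2 := ellFactorial_ne_zero h'.den_a_div (j + 1)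
  rw [show a * (q ^ 4 / κ) / q ^ 3 = a * q / κ by field_simp,
    show a * (q ^ 4 / κ) / q = a * q ^ 3 / κ by field_simp,
    show a * q / (q ^ 4 / κ) = a * κ / q ^ 3 by field_simp,
    show q ^ 3 / (q ^ 4 / κ) = κ / q by field_simp,
    show q ^ 4 / κ / q = q ^ 3 / κ by field_simp] at e2
  rw [show a * q / (q ^ 4 / κ) = a * κ / q ^ 3 by field_simp] at d2
  unfold expHead
  simp only [pow_zero, mul_one]
  rw [show a * (q ^ 4 / κ) / q ^ 3 = a * q / κ by field_simp,
    show a * (q ^ 4 / κ) / q = a * q ^ 3 / κ by field_simp]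
  have w : ∀ κ, expWeight p q a b κ 0 = 1 := fun κ => by simp [expWeight, ellFactorial_zero]
  rw [w, w]
  apply mul_right_cancel₀ (mul_ne_zero d2 d1)
  linear_combination (ellTheta (b / q) p * ellTheta (a ^ 2 / (b * q)) p) *
    ((ellTheta (a * q / κ) p * ellTheta (a * q ^ 3 / κ) p) * e1 -
      (ellTheta (a * κ / q ^ 3) p * ellTheta (a * κ / q) p) * e2)

/-- The reflection `κ ↦ q ^ 4 / κ` of the terminating very-well-poised series. -/
lemma expSum_reflect {p q a b κ : ℂ} (h : ExpGeneric p q a b κ)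
    (h' : ExpGeneric p q a b (q ^ 4 / κ)) (ha : ellTheta (a / q ^ 2) p ≠ 0)
    (hb : ellTheta (b / q) p * ellTheta (a ^ 2 / (b * q)) p ≠ 0) {M : ℕ}
    (hM : expWeight p q a b κ M = 0) (hM' : expWeight p q a b (q ^ 4 / κ) M = 0) :
    ellTheta (b * κ / q ^ 2) p * ellTheta (a ^ 2 * κ / (b * q ^ 2)) p *
        (ellTheta (a * q / κ) p * ellTheta (a * q ^ 3 / κ) p) * expSum p q a b κ (M + 1) =
      ellTheta (b * q ^ 2 / κ) p * ellTheta (a ^ 2 * q ^ 2 / (b * κ)) p *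
        (ellTheta (a * κ / q ^ 3) p * ellTheta (a * κ / q) p) *
        expSum p q a b (q ^ 4 / κ) (M + 1) := by
  have hq := h.q_ne
  have hκ := h.κ_ne
  have hb' := h.b_ne
  have e1 := expSum_eq h M
  have e2 := expSum_eq h' M
  have hs : (∑ j ∈ Finset.range M, expAux p q a b κ j) * expHead p q a b (q ^ 4 / κ) 0 =
      (∑ j ∈ Finset.range M, expAux p q a b (q ^ 4 / κ) j) * expHead p q a b κ 0 := by
    rw [Finset.sum_mul, Finset.sum_mul]
    exact Finset.sum_congr rfl fun j _ => expAux_symm h h' j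
  rw [expTail, hM, zero_mul, mul_zero, mul_zero, add_zero] at e1
  rw [expTail, hM', zero_mul, mul_zero, mul_zero, add_zero] at e2
  have w : ∀ κ, expWeight p q a b κ 0 = 1 := fun κ => by simp [expWeight, ellFactorial_zero]
  unfold expHead at e1 e2 hs
  simp only [pow_zero, mul_one, w, one_mul] at e1 e2 hs
  rw [show a * (q ^ 4 / κ) / q ^ 3 = a * q / κ by field_simp,
    show a * (q ^ 4 / κ) / q = a * q ^ 3 / κ by field_simp] at e2 hs
  rw [show b * (q ^ 4 / κ) / q ^ 2 = b * q ^ 2 / κ by field_simp,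
    show a ^ 2 * (q ^ 4 / κ) / (b * q ^ 2) = a ^ 2 * q ^ 2 / (b * κ) by field_simp] at e2
  apply mul_left_cancel₀ (mul_ne_zero (pow_ne_zero 2 ha) hb)
  linear_combination (ellTheta (a * q / κ) p * ellTheta (a * q ^ 3 / κ) p *
      (ellTheta (b / q) p * ellTheta (a ^ 2 / (b * q)) p)) * e1 -
    (ellTheta (a * κ / q ^ 3) p * ellTheta (a * κ / q) p *
      (ellTheta (b / q) p * ellTheta (a ^ 2 / (b * q)) p)) * e2 -
    a * ellTheta (a ^ 2 / q ^ 4) p * hs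

/-! ### Multiplicatively independent parameters -/

/-- The parameters `a`, `q`, `b` are multiplicatively independent modulo powers of the nome. For
`p = 0` this is multiplicative independence, as a monomial is never equal to `0`. -/
structure MulIndep (p q a b : ℂ) : Prop where
  norm_lt : ‖p‖ < 1
  q_ne : q ≠ 0
  a_ne : a ≠ 0
  b_ne : b ≠ 0
  eq_zero : ∀ i l m r : ℤ, a ^ i * q ^ l * b ^ m = p ^ r → i = 0 ∧ l = 0 ∧ m = 0

namespace MulIndep

variable {p q a b : ℂ}

lemma sq (h : MulIndep p q a b) : MulIndep (p ^ 2) q a b where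
  norm_lt := norm_sq_lt_one h.norm_lt
  q_ne := h.q_ne
  a_ne := h.a_ne
  b_ne := h.b_ne
  eq_zero i l m r hr := h.eq_zero i l m (2 * r) (by rw [hr, zpow_mul]; norm_cast)

/-- A theta function of a nontrivial monomial does not vanish. The monomial is written as a
fraction with natural exponents. -/
lemma ne (h : MulIndep p q a b) (i l m i' l' m' : ℕ) (hne : i ≠ i' ∨ l ≠ l' ∨ m ≠ m') {x : ℂ}
    (hx : x * (a ^ i' * q ^ l' * b ^ m') = a ^ i * q ^ l * b ^ m) : ellTheta x p ≠ 0 := by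
  have hq := h.q_ne
  have ha := h.a_ne
  have hb := h.b_ne
  have hx' : x = a ^ (i - i' : ℤ) * q ^ (l - l' : ℤ) * b ^ (m - m' : ℤ) := by
    rw [zpow_sub₀ ha, zpow_sub₀ hq, zpow_sub₀ hb]
    simp only [zpow_natCast]
    field_simp
    linear_combination hx
  intro h0
  have hx0 : x ≠ 0 := by rw [hx']; positivity
  obtain ⟨r, hr⟩ := exists_zpow_of_ellTheta_eq_zero h.norm_lt hx0 h0
  have := h.eq_zero _ _ _ r (hx' ▸ hr)
  omega

lemma neg_ne (h : MulIndep p q a b) (i l m i' l' m' : ℕ) (hne : i ≠ i' ∨ l ≠ l' ∨ m ≠ m') {x : ℂ}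
    (hx : x * (a ^ i' * q ^ l' * b ^ m') = a ^ i * q ^ l * b ^ m) : ellTheta (-x) p ≠ 0 := by
  have : ellTheta (x ^ 2) (p ^ 2) ≠ 0 :=
    h.sq.ne (2 * i) (2 * l) (2 * m) (2 * i') (2 * l') (2 * m') (by omega) (by
      simp only [mul_comm 2, pow_mul, ← mul_pow]
      rw [hx])
  rw [ellTheta_sq h.norm_lt] at this
  exact right_ne_zero_of_mul this

end MulIndep

/-! ### Evaluation of the very-well-poised expansion -/

/-- The quotient of shifted factorials that the very-well-poised series evaluates to, up to
factors free of `b`. -/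
noncomputable def expTarget (p q a b : ℂ) (k : ℕ) : ℂ :=
  ellFactorial (b * q / a ^ 2) (q ^ 2) p k *
    ellFactorial (b * q ^ (1 - 2 * (k : ℤ))) (q ^ 4) p k /
  (ellFactorial (b * q) (q ^ 2) p k *
    ellFactorial (b * q ^ (1 - 2 * (k : ℤ)) / a ^ 2) (q ^ 4) p k)

/-- In a shifted factorial whose argument depends on its length, passing from `k` to `k + 2` adds
one factor at each end. -/
lemma ellFactorial_centered_add_two {q : ℂ} (hq : q ≠ 0) (p c : ℂ) (k : ℕ) :
    ellFactorial (c * q ^ (1 - 2 * ((k + 2 : ℕ) : ℤ))) (q ^ 4) p (k + 2) =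
      ellFactorial (c * q ^ (1 - 2 * (k : ℤ))) (q ^ 4) p k *
        (ellTheta (c / (q ^ 3 * q ^ (2 * k))) p * ellTheta (c * q * q ^ (2 * k)) p) := by
  have e : q ^ (2 * (k : ℤ)) = q ^ (2 * k) := by norm_cast
  rw [ellFactorial_succ_left, ellFactorial_succ,
    show c * q ^ (1 - 2 * ((k + 2 : ℕ) : ℤ)) * q ^ 4 = c * q ^ (1 - 2 * (k : ℤ)) by
      rw [mul_assoc, ← zpow_natCast, ← zpow_add₀ hq]
      congr 2
      push_cast
      ring,
    show c * q ^ (1 - 2 * (k : ℤ)) * (q ^ 4) ^ k = c * q * q ^ (2 * k) by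
      rw [zpow_sub₀ hq, e, zpow_one]
      field_simp
      ring,
    show c * q ^ (1 - 2 * ((k + 2 : ℕ) : ℤ)) = c / (q ^ 3 * q ^ (2 * k)) by
      rw [show 1 - 2 * ((k + 2 : ℕ) : ℤ) = -(3 + 2 * k : ℕ) by push_cast; ring, zpow_neg,
        zpow_natCast, pow_add, div_eq_mul_inv]]
  ring

lemma ellFactorial_add_two (x q p : ℂ) (k : ℕ) :
    ellFactorial (x * q) (q ^ 2) p (k + 2) = ellFactorial (x * q) (q ^ 2) p k *
      (ellTheta (x * q * q ^ (2 * k)) p * ellTheta (x * q ^ 3 * q ^ (2 * k)) p) := by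
  rw [ellFactorial_succ, ellFactorial_succ, ← pow_mul, ← pow_mul,
    show x * q * q ^ (2 * (k + 1)) = x * q ^ 3 * q ^ (2 * k) by ring]
  ring

lemma ellFactorial_centered_ne_zero {q c p : ℂ} (hq : q ≠ 0)
    (h : ∀ i k : ℕ, ellTheta (c * q * q ^ i / q ^ (2 * k)) p ≠ 0) (k : ℕ) :
    ellFactorial (c * q ^ (1 - 2 * (k : ℤ))) (q ^ 4) p k ≠ 0 := by
  refine ellFactorial_ne_zero (fun i => ?_) k
  have e : q ^ (2 * (k : ℤ)) = q ^ (2 * k) := by norm_cast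
  convert h (4 * i) k using 2
  rw [zpow_sub₀ hq, e, zpow_one]
  ring

lemma expTarget_add_two {p q a b : ℂ} (h : MulIndep p q a b) (k : ℕ) :
    expTarget p q a b (k + 2) * (ellTheta (b * q ^ 3 * q ^ (2 * k)) p *
        ellTheta (b / a ^ 2 / (q ^ 3 * q ^ (2 * k))) p) =
      expTarget p q a b k * (ellTheta (b / (q ^ 3 * q ^ (2 * k))) p *
        ellTheta (b / a ^ 2 * q ^ 3 * q ^ (2 * k)) p) := by
  have hq := h.q_ne
  have ha := h.a_ne
  have hb := h.b_ne
  have g1 : ellTheta (b * q * q ^ (2 * k)) p ≠ 0 :=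
    h.ne 0 (1 + 2 * k) 1 0 0 0 (by omega) (by ring)
  have g2 : ellTheta (b * q ^ 3 * q ^ (2 * k)) p ≠ 0 :=
    h.ne 0 (3 + 2 * k) 1 0 0 0 (by omega) (by ring)
  have g3 : ellTheta (b / a ^ 2 / (q ^ 3 * q ^ (2 * k))) p ≠ 0 :=
    h.ne 0 0 1 2 (3 + 2 * k) 0 (by omega) (by field_simp; ring)
  have g4 : ellTheta (b / a ^ 2 * q * q ^ (2 * k)) p ≠ 0 :=
    h.ne 0 (1 + 2 * k) 1 2 0 0 (by omega) (by field_simp; ring)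
  have f1 : ellFactorial (b * q) (q ^ 2) p k ≠ 0 :=
    ellFactorial_ne_zero (fun i => h.ne 0 (1 + 2 * i) 1 0 0 0 (by omega) (by ring)) k
  have f2 : ellFactorial (b / a ^ 2 * q ^ (1 - 2 * (k : ℤ))) (q ^ 4) p k ≠ 0 :=
    ellFactorial_centered_ne_zero hq (fun i k =>
      h.ne 0 (1 + i) 1 2 (2 * k) 0 (by omega) (by field_simp; ring)) k
  unfold expTarget
  have e : ∀ x : ℂ, b * x / a ^ 2 = b / a ^ 2 * x := fun x => by ring
  simp only [e]
  rw [ellFactorial_centered_add_two hq, ellFactorial_centered_add_two hq, ellFactorial_add_two,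
    ellFactorial_add_two]
  generalize ellTheta (b * q * q ^ (2 * k)) p = t₁ at *
  generalize ellTheta (b * q ^ 3 * q ^ (2 * k)) p = t₂ at *
  generalize ellTheta (b / a ^ 2 / (q ^ 3 * q ^ (2 * k))) p = t₃ at *
  generalize ellTheta (b / a ^ 2 * q * q ^ (2 * k)) p = t₄ at *
  generalize ellTheta (b / (q ^ 3 * q ^ (2 * k))) p = t₅ at *
  generalize ellTheta (b / a ^ 2 * q ^ 3 * q ^ (2 * k)) p = t₆ at *
  generalize ellFactorial (b * q) (q ^ 2) p k = s₁ at *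
  generalize ellFactorial (b / a ^ 2 * q ^ (1 - 2 * (k : ℤ))) (q ^ 4) p k = s₂ at *
  field_simp

lemma expWeight_inv (p q a b κ : ℂ) (j : ℕ) : expWeight p q a b κ⁻¹ j = expWeight p q a b κ j := by
  unfold expWeight
  rw [show κ⁻¹ * q = q / κ by ring, show q / κ⁻¹ = κ * q by rw [div_inv_eq_mul, mul_comm],
    show a * q * κ⁻¹ = a * q / κ by ring, show a * q / κ⁻¹ = a * q * κ by rw [div_inv_eq_mul]]
  ring

lemma expSum_inv (p q a b κ : ℂ) (M : ℕ) : expSum p q a b κ⁻¹ M = expSum p q a b κ M := by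
  simp only [expSum, expWeight_inv]

lemma expWeight_eq_zero (p a b : ℂ) {q : ℂ} (hq : q ≠ 0) {k j : ℕ} (h : k < j) :
    expWeight p q a b (q ^ (2 * k + 1)) j = 0 := by
  unfold expWeight
  rw [ellFactorial_eq_zero (x := q / q ^ (2 * k + 1)) h (by field_simp; ring)]
  simp

lemma expSum_of_lt (p a b : ℂ) {q : ℂ} (hq : q ≠ 0) {k M : ℕ} (h : k < M) :
    expSum p q a b (q ^ (2 * k + 1)) M = expSum p q a b (q ^ (2 * k + 1)) (k + 1) := by
  refine (Finset.sum_subset (Finset.range_mono h) fun i _ hi => ?_).symm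
  rw [expWeight_eq_zero p a b hq (by simpa using hi), mul_zero]

lemma MulIndep.expGeneric {p q a b : ℂ} (h : MulIndep p q a b) (k : ℕ) :
    ExpGeneric p q a b (q ^ (2 * k + 1)) where
  norm_lt := h.norm_lt
  q_ne := h.q_ne
  a_ne := h.a_ne
  b_ne := h.b_ne
  κ_ne := pow_ne_zero _ h.q_ne
  den_q j := h.ne 0 (4 + 4 * j) 0 0 0 0 (by omega) (by ring)
  den_aκ j := h.ne 1 (1 + (2 * k + 1) + 2 * j) 0 0 0 0 (by omega) (by ring)
  den_a_div j := h.ne 1 (1 + 2 * j) 0 0 (2 * k + 1) 0 (by omega) (by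
    have := h.q_ne; field_simp; ring)
  den_b j := h.ne 0 (1 + 2 * j) 1 0 0 0 (by omega) (by ring)
  den_a_sq j := h.ne 2 (1 + 2 * j) 0 0 0 1 (by omega) (by
    have := h.b_ne; field_simp; ring)

lemma ExpGeneric.inv {p q a b κ : ℂ} (h : ExpGeneric p q a b κ) : ExpGeneric p q a b κ⁻¹ where
  norm_lt := h.norm_lt
  q_ne := h.q_ne
  a_ne := h.a_ne
  b_ne := h.b_ne
  κ_ne := inv_ne_zero h.κ_ne
  den_q := h.den_q
  den_aκ := h.den_a_div
  den_a_div j := by rw [div_inv_eq_mul]; exact h.den_aκ j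
  den_b := h.den_b
  den_a_sq := h.den_a_sq

/-- The reflection `κ ↦ q ^ 4 / κ`, combined with `κ ↦ κ⁻¹`, relates `κ = q ^ (2 k + 5)` to
`κ = q ^ (2 k + 1)`. -/
lemma expSum_add_two {p q a b : ℂ} (h : MulIndep p q a b) (k : ℕ) :
    ellTheta (b * q ^ 3 * q ^ (2 * k)) p * ellTheta (a ^ 2 / b * (q ^ 3 * q ^ (2 * k))) p *
        (ellTheta (a / (q ^ 4 * q ^ (2 * k))) p * ellTheta (a / (q ^ 2 * q ^ (2 * k))) p) *
        expSum p q a b (q ^ (2 * (k + 2) + 1)) (k + 3) =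
      ellTheta (b / (q ^ 3 * q ^ (2 * k))) p * ellTheta (a ^ 2 / b / (q ^ 3 * q ^ (2 * k))) p *
        (ellTheta (a * q ^ 2 * q ^ (2 * k)) p * ellTheta (a * q ^ 4 * q ^ (2 * k)) p) *
        expSum p q a b (q ^ (2 * k + 1)) (k + 1) := by
  have hq := h.q_ne
  have ha := h.a_ne
  have hb := h.b_ne
  have e : q ^ 4 / q ^ (2 * (k + 2) + 1) = (q ^ (2 * k + 1))⁻¹ := by field_simp; ring
  have := expSum_reflect (M := k + 3) (h.expGeneric (k + 2)) (e ▸ (h.expGeneric k).inv)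
    (h.ne 1 0 0 0 2 0 (by omega) (by field_simp))
    (mul_ne_zero (h.ne 0 0 1 0 1 0 (by omega) (by field_simp))
      (h.ne 2 0 0 0 1 1 (by omega) (by field_simp)))
    (expWeight_eq_zero p a b hq (by omega))
    (by rw [e, expWeight_inv, expWeight_eq_zero p a b hq (by omega)])
  rw [e, expSum_inv, expSum_of_lt p a b hq (by omega : k + 2 < k + 3 + 1),
    expSum_of_lt p a b hq (by omega : k < k + 3 + 1)] at this
  convert this using 5 <;> first | ring1 | (field_simp; done) | (field_simp; ring1)

/-- The reflection relates `κ = q ^ 3` to `κ = q`. -/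
lemma expSum_one {p q a b : ℂ} (h : MulIndep p q a b) :
    ellTheta (b * q) p * ellTheta (a ^ 2 * q / b) p *
        (ellTheta (a / q ^ 2) p * ellTheta a p) * expSum p q a b (q ^ (2 * 1 + 1)) 2 =
      ellTheta (b / q) p * ellTheta (a ^ 2 / (b * q)) p *
        (ellTheta a p * ellTheta (a * q ^ 2) p) * expSum p q a b (q ^ (2 * 0 + 1)) 1 := by
  have hq := h.q_ne
  have ha := h.a_ne
  have hb := h.b_ne
  have e : q ^ 4 / q ^ (2 * 1 + 1) = q ^ (2 * 0 + 1) := by field_simp; ring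
  have := expSum_reflect (M := 2) (h.expGeneric 1) (e ▸ (h.expGeneric 0))
    (h.ne 1 0 0 0 2 0 (by omega) (by field_simp))
    (mul_ne_zero (h.ne 0 0 1 0 1 0 (by omega) (by field_simp))
      (h.ne 2 0 0 0 1 1 (by omega) (by field_simp)))
    (expWeight_eq_zero p a b hq (by omega))
    (by rw [e, expWeight_eq_zero p a b hq (by omega)])
  rw [e, expSum_of_lt p a b hq (by omega : 1 < 2 + 1),
    expSum_of_lt p a b hq (by omega : 0 < 2 + 1)] at this
  convert this using 5 <;> first | ring1 | field_simp

/-- Evaluation of the terminating very-well-poised series. -/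
lemma expTarget_eq_expSum {p q a b : ℂ} (h : MulIndep p q a b) (k : ℕ) :
    expTarget p q a b k * (ellTheta a p * ellFactorial (a * q ^ 2) (q ^ 2) p k) =
      (-a) ^ k * ellFactorial (q ^ 2 / a) (q ^ 2) p k *
        expSum p q a b (q ^ (2 * k + 1)) (k + 1) := by
  have hq := h.q_ne
  have ha := h.a_ne
  have hb := h.b_ne
  have hp := h.norm_lt
  induction k using Nat.twoStepInduction with
  | zero => simp [expTarget, expSum, expWeight, ellFactorial_zero]
  | one =>
    have hs := expSum_one h
    have i1 := ellTheta_inv (x := a / q ^ 2) hp (by positivity)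
    have i2 := ellTheta_inv (x := a ^ 2 / (b * q)) hp (by positivity)
    have i3 := ellTheta_inv (x := a ^ 2 * q / b) hp (by positivity)
    rw [inv_div] at i1 i2 i3
    have g1 : ellTheta (b * q) p ≠ 0 := h.ne 0 1 1 0 0 0 (by omega) (by ring)
    have g2 : ellTheta (a ^ 2 * q / b) p ≠ 0 := h.ne 2 1 0 0 0 1 (by omega) (by field_simp)
    have g3 : ellTheta a p ≠ 0 := h.ne 1 0 0 0 0 0 (by omega) (by ring)
    have s0 : expSum p q a b (q ^ (2 * 0 + 1)) 1 = ellTheta a p := by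
      simp [expSum, expWeight, ellFactorial_zero]
    rw [s0] at hs
    unfold expTarget
    simp only [ellFactorial, Finset.prod_range_one, pow_zero, mul_one, pow_one]
    rw [show b * q ^ (1 - 2 * ((1 : ℕ) : ℤ)) / a ^ 2 = b / (a ^ 2 * q) by norm_num; field_simp,
      show b * q ^ (1 - 2 * ((1 : ℕ) : ℤ)) = b / q by norm_num; field_simp, i1, i2, i3]
    generalize expSum p q a b (q ^ (2 * 1 + 1)) (1 + 1) = S at *
    generalize ellTheta (b * q) p = t₁ at *
    generalize ellTheta (a ^ 2 * q / b) p = t₂ at *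
    generalize ellTheta (a / q ^ 2) p = t₃ at *
    generalize ellTheta a p = t₄ at *
    generalize ellTheta (b / q) p = t₅ at *
    generalize ellTheta (a ^ 2 / (b * q)) p = t₆ at *
    generalize ellTheta (a * q ^ 2) p = t₇ at *
    field_simp
    apply mul_right_cancel₀ g3
    linear_combination -hs
  | more k ih _ =>
    have hs := expSum_add_two h k
    have ht := expTarget_add_two h k
    have i1 := ellTheta_inv (x := a / (q ^ 4 * q ^ (2 * k))) hp (by positivity)
    have i2 := ellTheta_inv (x := a / (q ^ 2 * q ^ (2 * k))) hp (by positivity)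
    have i3 := ellTheta_inv (x := a ^ 2 / b * (q ^ 3 * q ^ (2 * k))) hp (by positivity)
    have i4 := ellTheta_inv (x := a ^ 2 / b / (q ^ 3 * q ^ (2 * k))) hp (by positivity)
    have g1 : ellTheta (b * q ^ 3 * q ^ (2 * k)) p ≠ 0 :=
      h.ne 0 (3 + 2 * k) 1 0 0 0 (by omega) (by ring)
    have g2 : ellTheta (a ^ 2 / b * (q ^ 3 * q ^ (2 * k))) p ≠ 0 :=
      h.ne 2 (3 + 2 * k) 0 0 0 1 (by omega) (by field_simp; ring)
    rw [ellFactorial_succ (q ^ 2 / a), ellFactorial_succ (q ^ 2 / a), ellFactorial_succ (a * q ^ 2),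
      ellFactorial_succ (a * q ^ 2), ← pow_mul, ← pow_mul,
      show a * q ^ 2 * q ^ (2 * (k + 1)) = a * q ^ 4 * q ^ (2 * k) by ring,
      show q ^ 2 / a * q ^ (2 * (k + 1)) = (a / (q ^ 4 * q ^ (2 * k)))⁻¹ by field_simp; ring, i1,
      show q ^ 2 / a * q ^ (2 * k) = (a / (q ^ 2 * q ^ (2 * k)))⁻¹ by field_simp, i2]
    rw [show b / a ^ 2 / (q ^ 3 * q ^ (2 * k)) = (a ^ 2 / b * (q ^ 3 * q ^ (2 * k)))⁻¹ by
        field_simp, i3,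
      show b / a ^ 2 * q ^ 3 * q ^ (2 * k) = (a ^ 2 / b / (q ^ 3 * q ^ (2 * k)))⁻¹ by
        field_simp, i4] at ht
    clear i1 i2 i3 i4
    have hz : q ^ (2 * k) ≠ 0 := by positivity
    generalize expTarget p q a b (k + 2) = T' at *
    generalize expTarget p q a b k = T at *
    generalize expSum p q a b (q ^ (2 * (k + 2) + 1)) (k + 3) = S' at *
    generalize expSum p q a b (q ^ (2 * k + 1)) (k + 1) = S at *
    generalize q ^ (2 * k) = z at *
    generalize ellTheta (b * q ^ 3 * z) p = t₁ at *
    generalize ellTheta (a ^ 2 / b * (q ^ 3 * z)) p = t₂ at *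
    generalize ellTheta (a / (q ^ 4 * z)) p = t₃ at *
    generalize ellTheta (a / (q ^ 2 * z)) p = t₄ at *
    generalize ellTheta (b / (q ^ 3 * z)) p = t₅ at *
    generalize ellTheta (a ^ 2 / b / (q ^ 3 * z)) p = t₆ at *
    generalize ellTheta (a * q ^ 2 * z) p = t₇ at *
    generalize ellTheta (a * q ^ 4 * z) p = t₈ at *
    generalize ellTheta a p = t₉ at *
    generalize ellFactorial (q ^ 2 / a) (q ^ 2) p k = s₁ at *
    generalize ellFactorial (a * q ^ 2) (q ^ 2) p k = s₂ at *
    rw [pow_add]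
    generalize (-a) ^ k = c at *
    field_simp at ht ⊢
    apply mul_left_cancel₀ (mul_ne_zero g1 g2)
    linear_combination -(t₉ * s₂ * t₇ * t₈) * ht + q ^ 6 * z ^ 2 * t₅ * t₆ * t₇ * t₈ * ih -
      q ^ 6 * z ^ 2 * c * s₁ * hs

/-! ### Interchange of summation -/

/-- The factor of the very-well-poised weight that depends on the summation index `k` of the
other series. -/
noncomputable def expCoupling (p q a : ℂ) (k j : ℕ) : ℂ :=
  (-a) ^ k * ellFactorial (q ^ 2 / a) (q ^ 2) p k / ellFactorial (a * q ^ 2) (q ^ 2) p k *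
    (ellFactorial (q ^ (2 * k + 1) * q) (q ^ 2) p j *
      ellFactorial (q / q ^ (2 * k + 1)) (q ^ 2) p j /
    (ellFactorial (a * q * q ^ (2 * k + 1)) (q ^ 2) p j *
      ellFactorial (a * q / q ^ (2 * k + 1)) (q ^ 2) p j))

/-- For `k = j + i` the coupling factor separates into shifted factorials of lengths `2 j` and
`i`. -/
lemma expCoupling_add {p q a b : ℂ} (h : MulIndep p q a b) (j i : ℕ) :
    expCoupling p q a (j + i) j =
      (-a) ^ i * (-1) ^ j * (ellFactorial (q ^ 2) (q ^ 2) p (2 * j) /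
        ellFactorial (a * q ^ 2) (q ^ 2) p (2 * j)) *
      (ellFactorial (q ^ 2 * q ^ (4 * j)) (q ^ 2) p i * ellFactorial (q ^ 2 / a) (q ^ 2) p i /
        (ellFactorial (q ^ 2) (q ^ 2) p i *
          ellFactorial (a * q ^ 2 * q ^ (4 * j)) (q ^ 2) p i)) := by
  have hq := h.q_ne
  have ha := h.a_ne
  have hp := h.norm_lt
  have hq2 : q ^ 2 ≠ 0 := by positivity
  unfold expCoupling
  have r1 := ellFactorial_add (q ^ 2) (q ^ 2) p (2 * j) i
  rw [show 2 * j + i = j + i + j by ring, ellFactorial_add,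
    show q ^ 2 * (q ^ 2) ^ (j + i) = q ^ (2 * (j + i) + 1) * q by ring,
    show q ^ 2 * (q ^ 2) ^ (2 * j) = q ^ 2 * q ^ (4 * j) by ring] at r1
  have r2 := ellFactorial_add (a * q ^ 2) (q ^ 2) p (2 * j) i
  rw [show 2 * j + i = j + i + j by ring, ellFactorial_add,
    show a * q ^ 2 * (q ^ 2) ^ (j + i) = a * q * q ^ (2 * (j + i) + 1) by ring,
    show a * q ^ 2 * (q ^ 2) ^ (2 * j) = a * q ^ 2 * q ^ (4 * j) by ring] at r2
  have r3 := ellFactorial_add_reverse (y := q ^ (2 * (j + i))) hp hq2 hq2 i j (by ring)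
  rw [show (q ^ (2 * (j + i)))⁻¹ = q / q ^ (2 * (j + i) + 1) by field_simp; ring] at r3
  have r4 := ellFactorial_add_reverse (x := q ^ 2 / a) (y := q ^ (2 * (j + i)) / a) hp hq2
    (by positivity) i j (by ring)
  rw [show (q ^ (2 * (j + i)) / a)⁻¹ = a * q / q ^ (2 * (j + i) + 1) by field_simp; ring] at r4
  have hprod : (∏ l ∈ Finset.range j, -(q ^ (2 * (j + i)) / (q ^ 2) ^ l)) =
      a ^ j * ∏ l ∈ Finset.range j, -(q ^ (2 * (j + i)) / a / (q ^ 2) ^ l) := by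
    have : a ^ j = ∏ _l ∈ Finset.range j, a := by simp
    rw [this, ← Finset.prod_mul_distrib]
    exact Finset.prod_congr rfl fun l _ => by field_simp
  have hQ : (∏ l ∈ Finset.range j, -(q ^ (2 * (j + i)) / a / (q ^ 2) ^ l)) ≠ 0 :=
    Finset.prod_ne_zero_iff.mpr fun l _ => neg_ne_zero.mpr (by positivity)
  rw [hprod] at r3
  rw [add_comm i j] at r3 r4
  have n1 (m : ℕ) : ellFactorial (q ^ 2) (q ^ 2) p m ≠ 0 :=
    ellFactorial_ne_zero (fun l => h.ne 0 (2 + 2 * l) 0 0 0 0 (by omega) (by ring)) m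
  have n2 (m : ℕ) : ellFactorial (a * q ^ 2) (q ^ 2) p m ≠ 0 :=
    ellFactorial_ne_zero (fun l => h.ne 1 (2 + 2 * l) 0 0 0 0 (by omega) (by ring)) m
  have n3 (m : ℕ) : ellFactorial (q ^ 2 / a) (q ^ 2) p m ≠ 0 :=
    ellFactorial_ne_zero (fun l => h.ne 0 (2 + 2 * l) 0 1 0 0 (by omega) (by field_simp; ring)) m
  have n4 : ellFactorial (a * q ^ 2 * q ^ (4 * j)) (q ^ 2) p i ≠ 0 :=
    ellFactorial_ne_zero (fun l => h.ne 1 (2 + 4 * j + 2 * l) 0 0 0 0 (by omega) (by ring)) i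
  have n5 : ellFactorial (a * q * q ^ (2 * (j + i) + 1)) (q ^ 2) p j ≠ 0 :=
    ellFactorial_ne_zero (fun l => h.ne 1 (1 + (2 * (j + i) + 1) + 2 * l) 0 0 0 0 (by omega)
      (by ring)) j
  have n6 : ellFactorial (a * q / q ^ (2 * (j + i) + 1)) (q ^ 2) p j ≠ 0 :=
    right_ne_zero_of_mul (right_ne_zero_of_mul (r4 ▸ n3 (j + i)))
  have m1 := n1 i
  have m2 := n1 (j + i)
  have m3 := n2 (2 * j)
  have m4 := n2 (j + i)
  have m5 := n3 i
  have m6 := n3 (j + i)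
  clear n1 n2 n3 hprod
  rw [pow_add, show (-a) ^ j = (-1) ^ j * a ^ j by rw [neg_pow]]
  generalize (∏ l ∈ Finset.range j, -(q ^ (2 * (j + i)) / a / (q ^ 2) ^ l)) = Q at *
  generalize ellFactorial (q ^ 2) (q ^ 2) p (2 * j) = s₁ at *
  generalize ellFactorial (a * q ^ 2) (q ^ 2) p (2 * j) = s₂ at *
  generalize ellFactorial (q ^ 2 * q ^ (4 * j)) (q ^ 2) p i = s₃ at *
  generalize ellFactorial (a * q ^ 2 * q ^ (4 * j)) (q ^ 2) p i = s₄ at *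
  generalize ellFactorial (q ^ (2 * (j + i) + 1) * q) (q ^ 2) p j = s₅ at *
  generalize ellFactorial (a * q * q ^ (2 * (j + i) + 1)) (q ^ 2) p j = s₆ at *
  generalize ellFactorial (q / q ^ (2 * (j + i) + 1)) (q ^ 2) p j = s₇ at *
  generalize ellFactorial (a * q / q ^ (2 * (j + i) + 1)) (q ^ 2) p j = s₈ at *
  generalize ellFactorial (q ^ 2) (q ^ 2) p i = s₉ at *
  generalize ellFactorial (q ^ 2 / a) (q ^ 2) p i = s₁₀ at *
  generalize ellFactorial (q ^ 2) (q ^ 2) p (j + i) = s₁₁ at *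
  generalize ellFactorial (q ^ 2 / a) (q ^ 2) p (j + i) = s₁₂ at *
  generalize ellFactorial (a * q ^ 2) (q ^ 2) p (j + i) = s₁₃ at *
  generalize (-a) ^ i = c₁ at *
  generalize ((-1 : ℂ)) ^ j = c₂ at *
  have haj : a ^ j ≠ 0 := by positivity
  generalize a ^ j = c₃ at *
  field_simp
  linear_combination (c₂ * c₁ * s₅ * s₂ * s₄ * c₃ * s₇ * s₉) * r4 -
    (c₂ * c₁ * s₅ * s₂ * s₄ * s₁₀ * s₈) * r3 + (c₂ * c₁ * s₂ * s₄ * s₁₀ * s₈) * r1 -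
    (c₂ * c₁ * s₁ * s₃ * s₁₀ * s₈) * r2

/-- The part of the summand of the single series on the right that is free of `b`. -/
noncomputable def outerCoeff (p q a : ℂ) (n k : ℕ) : ℂ :=
  ellTheta (q ^ (4 * k + 2)) (p ^ 2) *
      (ellFactorial (a * q ^ ((n : ℤ) - 2)) q p k * ellFactorial (q ^ (-(n : ℤ))) q p k) /
    (ellTheta (q ^ 2) (p ^ 2) *
      (ellFactorial (q ^ (4 - (n : ℤ)) / a) q p k * ellFactorial (q ^ ((n : ℤ) + 2)) q p k)) *
    (-q ^ 2 / a) ^ k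

/-- The normalization of the inner series after the interchange of summations. -/
noncomputable def innerConst (p q a : ℂ) (n j : ℕ) : ℂ :=
  ellFactorial (a * q ^ ((n : ℤ) - 2)) q p j * ellFactorial (q ^ (-(n : ℤ))) q p j /
    (ellTheta (q ^ 2) (p ^ 2) *
      (ellFactorial (q ^ (4 - (n : ℤ)) / a) q p j * ellFactorial (q ^ ((n : ℤ) + 2)) q p j)) *
    (q ^ 2 / a) ^ j *
    (ellFactorial (q ^ 2) (q ^ 2) (p ^ 2) (2 * j) /
      ellFactorial (a * q ^ 2) (q ^ 2) (p ^ 2) (2 * j))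

/-- For fixed `j`, the sum over `k = j + i` is a terminating quadratic series of length
`N = n - j`. -/
lemma outerCoeff_mul_expCoupling {p q a b : ℂ} (h : MulIndep p q a b) (N j i : ℕ) :
    outerCoeff p q a (j + N) (j + i) * expCoupling (p ^ 2) q a (j + i) j =
      innerConst p q a (j + N) j * (ellTheta ((q ^ (2 * j + 1)) ^ 2 * q ^ (4 * i)) (p ^ 2) *
        quadWeight p q (q ^ (2 * j + 1)) (q ^ 2 / a)
          (q ^ (2 * j + 1) * q ^ N / (q * (q ^ 2 / a))) (q ^ N)⁻¹ i * q ^ (2 * i)) := by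
  have hq := h.q_ne
  have ha := h.a_ne
  rw [expCoupling_add h.sq]
  unfold outerCoeff innerConst quadWeight
  have e1 : q ^ (((j + N : ℕ) : ℤ)) = q ^ j * q ^ N := by rw [zpow_natCast, pow_add]
  simp only [zpow_sub₀ hq, zpow_add₀ hq, zpow_neg, e1, zpow_ofNat]
  simp only [ellFactorial_add _ _ _ j i]
  rw [show a * (q ^ j * q ^ N / q ^ 2) * q ^ j = q ^ (2 * j + 1) * q ^ N / (q * (q ^ 2 / a)) by
      field_simp; ring,
    show (q ^ j * q ^ N)⁻¹ * q ^ j = (q ^ N)⁻¹ by field_simp,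
    show q ^ (2 * j + 1) * q / (q ^ (2 * j + 1) * q ^ N / (q * (q ^ 2 / a))) =
      q ^ 4 / (q ^ j * q ^ N) / a * q ^ j by field_simp,
    show q ^ (2 * j + 1) * q / (q ^ N)⁻¹ = q ^ j * q ^ N * q ^ 2 * q ^ j by field_simp; ring,
    show (q ^ (2 * j + 1)) ^ 2 * q ^ (4 * i) = q ^ (4 * (j + i) + 2) by ring,
    show (q ^ (2 * j + 1)) ^ 2 = q ^ 2 * q ^ (4 * j) by ring,
    show q ^ 2 * q ^ (4 * j) * q ^ 2 / (q ^ 2 / a) = a * q ^ 2 * q ^ (4 * j) by field_simp,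
    show (-q ^ 2 / a) ^ (j + i) = (-1) ^ j * (q ^ 2 / a) ^ j * (-q ^ 2 / a) ^ i by
      rw [pow_add, ← mul_pow]; ring]
  have ec : (-q ^ 2 / a) ^ i * (-a) ^ i = q ^ (2 * i) := by
    rw [← mul_pow, pow_mul]; congr 1; field_simp
  have ed : ((-1 : ℂ)) ^ j * (-1) ^ j = 1 := by rw [← mul_pow]; simp
  rw [← ec]
  -- the two signs `(-1) ^ j` cancel
  conv_rhs => rw [← one_mul (_ * _), ← ed]
  ring

lemma MulIndep.quadGeneric {p q a b : ℂ} (h : MulIndep p q a b) (j : ℕ) :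
    QuadGeneric p q (q ^ (2 * j + 1)) (q ^ 2 / a) where
  norm_lt := h.norm_lt
  q_ne := h.q_ne
  X_ne := pow_ne_zero _ h.q_ne
  B_ne := div_ne_zero (pow_ne_zero _ h.q_ne) h.a_ne
  pow_ne m := h.ne 0 (m + 1) 0 0 0 0 (by omega) (by ring)
  neg_pow_ne m := h.neg_ne 0 (m + 1) 0 0 0 0 (by omega) (by ring)
  X_pow_ne m := h.ne 0 (2 * j + 1 + m + 1) 0 0 0 0 (by omega) (by ring)
  X_div_B_ne m := by
    have hq := h.q_ne
    have ha := h.a_ne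
    obtain ⟨n, rfl | rfl⟩ := m.eq_nat_or_neg
    · exact h.ne 1 (2 * j + 1 + n) 0 0 2 0 (by omega) (by rw [zpow_natCast]; field_simp; ring)
    · exact h.ne 1 (2 * j + 1) 0 0 (2 + n) 0 (by omega)
        (by rw [zpow_neg, zpow_natCast]; field_simp; ring)
  neg_X_div_B_ne m := by
    have hq := h.q_ne
    have ha := h.a_ne
    obtain ⟨n, rfl | rfl⟩ := m.eq_nat_or_neg
    · exact h.neg_ne 1 (2 * j + 1 + n) 0 0 2 0 (by omega) (by rw [zpow_natCast]; field_simp; ring)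
    · exact h.neg_ne 1 (2 * j + 1) 0 0 (2 + n) 0 (by omega)
        (by rw [zpow_neg, zpow_natCast]; field_simp; ring)
  B_zpow_ne m := by
    have hq := h.q_ne
    have ha := h.a_ne
    obtain ⟨n, rfl | rfl⟩ := m.eq_nat_or_neg
    · exact h.ne 0 (2 + n) 0 1 0 0 (by omega) (by rw [zpow_natCast]; field_simp; ring)
    · exact h.ne 0 2 0 1 n 0 (by omega) (by rw [zpow_neg, zpow_natCast]; field_simp)
  X_sq_div_B_ne m := by
    have hq := h.q_ne
    have ha := h.a_ne
    obtain ⟨n, rfl | rfl⟩ := m.eq_nat_or_neg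
    · exact h.sq.ne 1 (4 * j + 2 + n) 0 0 2 0 (by omega) (by rw [zpow_natCast]; field_simp; ring)
    · exact h.sq.ne 1 (4 * j + 2) 0 0 (2 + n) 0 (by omega)
        (by rw [zpow_neg, zpow_natCast]; field_simp; ring)
  B_zpow_ne' m := by
    have hq := h.q_ne
    have ha := h.a_ne
    obtain ⟨n, rfl | rfl⟩ := m.eq_nat_or_neg
    · exact h.sq.ne 0 (2 + n) 0 1 0 0 (by omega) (by rw [zpow_natCast]; field_simp; ring)
    · exact h.sq.ne 0 2 0 1 n 0 (by omega) (by rw [zpow_neg, zpow_natCast]; field_simp)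

/-- The factor in front of the single series on the right. -/
noncomputable def outerConst (p q a : ℂ) (n : ℕ) : ℂ :=
  (ellTheta (-a / q ^ 2) p * (ellFactorial (-q) q p n * ellFactorial (a / q ^ 3) q p n) *
      ellFactorial (a * q ^ 2) (q ^ 2) (p ^ 2) n) /
    (ellTheta (-a * q ^ (2 * (n : ℤ) - 2)) p *
      (ellFactorial (-a / q ^ 2) q p n * ellFactorial (q ^ 2) q p n) *
      ellFactorial (a / q ^ 4) (q ^ 2) (p ^ 2) n) * q ^ (-(n : ℤ))

/-- The closed form of the quadratic series turns the inner sum into the coefficient on the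
left-hand side of the transformation. -/
lemma outerConst_mul_quadTerminating {p q a b : ℂ} (h : MulIndep p q a b) (N j : ℕ) :
    outerConst p q a (j + N) * (innerConst p q a (j + N) j *
        quadTerminating p q (q ^ (2 * j + 1)) (q ^ 2 / a) N) =
      ellFactorial (a ^ 2 * q ^ (2 * ((j + N : ℕ) : ℤ) - 4)) (q ^ 2) (p ^ 2) j *
          ellFactorial (q ^ (-2 * ((j + N : ℕ) : ℤ))) (q ^ 2) (p ^ 2) j *
          ellFactorial (-q ^ 2) q p (2 * j) /
        (ellFactorial (q ^ (6 - 2 * ((j + N : ℕ) : ℤ)) / a) (q ^ 2) (p ^ 2) j *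
          ellFactorial (a * q ^ (2 * ((j + N : ℕ) : ℤ) + 2)) (q ^ 2) (p ^ 2) j *
          ellFactorial (-a / q) q p (2 * j)) * (q ^ 3 / a) ^ j := by
  have hq := h.q_ne
  have ha := h.a_ne
  have hp := h.norm_lt
  have hp2 := norm_sq_lt_one hp
  have hq2 : q ^ 2 ≠ 0 := by positivity
  have hn : q ^ (j + N) ≠ 0 := by positivity
  have key := quadTerminating_closed (h.quadGeneric j) N
  rw [show -(q ^ (2 * j + 1) / (q * (q ^ 2 / a))) = -a / q ^ 2 * q ^ (2 * j) by field_simp; ring,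
    show 1 / (q * (q ^ 2 / a)) = a / q ^ 3 by field_simp,
    show (q ^ (2 * j + 1)) ^ 2 * q ^ 2 / (q ^ 2 / a) = a * q ^ 2 * (q ^ 2) ^ (2 * j) by
      field_simp; ring,
    show -(q ^ (2 * j + 1) * q ^ (2 * N) / (q * (q ^ 2 / a))) = -a * q ^ (2 * (j + N)) / q ^ 2 by
      field_simp; ring,
    show q ^ (2 * j + 1) * q = q ^ 2 * q ^ (2 * j) by ring,
    show 1 / (q ^ 2 * (q ^ 2 / a)) = a / q ^ 4 by field_simp] at key
  have z1 : q ^ ((j + N : ℕ) : ℤ) = q ^ (j + N) := zpow_natCast _ _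
  have z2 : q ^ (2 * ((j + N : ℕ) : ℤ)) = q ^ (2 * (j + N)) := by
    rw [← zpow_natCast]; push_cast; rfl
  unfold outerConst innerConst
  simp only [neg_mul, zpow_sub₀ hq, zpow_add₀ hq, zpow_neg, z1, z2, zpow_ofNat]
  -- factors in nome `p ^ 2`
  have r1 := ellFactorial_add (a * q ^ 2) (q ^ 2) (p ^ 2) (2 * j) N
  rw [show 2 * j + N = j + N + j by ring, ellFactorial_add _ _ _ (j + N) j,
    show a * q ^ 2 * (q ^ 2) ^ (j + N) = a * (q ^ (2 * (j + N)) * q ^ 2) by ring] at r1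
  have r2 := ellFactorial_add_reverse (x := a / q ^ 4) (y := a * q ^ (2 * (j + N)) / q ^ 6) hp2 hq2
    (by positivity) N j (by field_simp; ring)
  rw [show (a * q ^ (2 * (j + N)) / q ^ 6)⁻¹ = q ^ 6 / q ^ (2 * (j + N)) / a by field_simp] at r2
  have r3 := ellFactorial_sq hp (a * (q ^ (j + N) / q ^ 2)) q j
  rw [show (a * (q ^ (j + N) / q ^ 2)) ^ 2 = a ^ 2 * (q ^ (2 * (j + N)) / q ^ 4) by
    field_simp; ring] at r3
  have r4 := ellFactorial_sq hp (q ^ (j + N))⁻¹ q j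
  rw [show ((q ^ (j + N))⁻¹) ^ 2 = (q ^ (2 * (j + N)))⁻¹ by field_simp; ring] at r4
  have r5 := ellFactorial_sq hp q q (2 * j)
  have r6 := ellTheta_sq hp q
  have r7 := ellTheta_sq hp (q ^ (2 * j + 1))
  -- factors in nome `p`
  have r8 := ellFactorial_add (-a / q ^ 2) q p (2 * j) N
  rw [show 2 * j + N = j + N + j by ring, ellFactorial_add _ _ _ (j + N) j,
    show -a / q ^ 2 * q ^ (j + N) = -(a * (q ^ (j + N) / q ^ 2)) by ring] at r8
  have r9 := ellFactorial_succ_left (-a / q ^ 2) q p (2 * j)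
  rw [ellFactorial_succ, show -a / q ^ 2 * q = -a / q by field_simp] at r9
  have r10 := ellFactorial_add (q ^ 2) q p (2 * j) N
  rw [show 2 * j + N = j + N + j by ring, ellFactorial_add _ _ _ (j + N) j,
    show q ^ 2 * q ^ (j + N) = q ^ (j + N) * q ^ 2 by ring] at r10
  have r11 := ellFactorial_succ_left q q p (2 * j)
  rw [ellFactorial_succ, show q * q = q ^ 2 by ring, show q * q ^ (2 * j) = q ^ (2 * j + 1) by ring]
    at r11
  have r12 := ellFactorial_succ_left (-q) q p (2 * j)
  rw [ellFactorial_succ, show -q * q = -q ^ 2 by ring,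
    show -q * q ^ (2 * j) = -q ^ (2 * j + 1) by ring] at r12
  have r13 := ellFactorial_add_reverse (x := -q) (y := -q ^ (j + N)) hp hq
    (neg_ne_zero.mpr hq) N j (by ring)
  rw [inv_neg] at r13
  have r14 := ellFactorial_add_reverse (x := a / q ^ 3) (y := a * q ^ (j + N) / q ^ 4) hp hq
    (by positivity) N j (by field_simp; ring)
  rw [show (a * q ^ (j + N) / q ^ 4)⁻¹ = q ^ 4 / q ^ (j + N) / a by field_simp] at r14
  -- the monomials produced by the reversals
  have hprod : (∏ l ∈ Finset.range j, -(a * q ^ (2 * (j + N)) / q ^ 6 / (q ^ 2) ^ l)) =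
      (∏ l ∈ Finset.range j, -(-q ^ (j + N) / q ^ l)) *
      (∏ l ∈ Finset.range j, -(a * q ^ (j + N) / q ^ 4 / q ^ l)) / q ^ (2 * j) := by
    have e1 : q ^ (2 * j) = ∏ _l ∈ Finset.range j, q ^ 2 := by simp [pow_mul]
    rw [e1, ← Finset.prod_mul_distrib, ← Finset.prod_div_distrib]
    refine Finset.prod_congr rfl fun l _ => ?_
    field_simp
    ring
  have hQ1 : (∏ l ∈ Finset.range j, -(-q ^ (j + N) / q ^ l)) ≠ 0 :=
    Finset.prod_ne_zero_iff.mpr fun l _ => by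
      rw [neg_div, neg_neg]
      positivity
  have hQ2 : (∏ l ∈ Finset.range j, -(a * q ^ (j + N) / q ^ 4 / q ^ l)) ≠ 0 :=
    Finset.prod_ne_zero_iff.mpr fun l _ => neg_ne_zero.mpr (by positivity)
  rw [hprod] at r2
  -- non-vanishing of all factors
  have n1 : ellTheta (-a * q ^ (2 * (j + N)) / q ^ 2) p ≠ 0 := by
    rw [neg_mul, neg_div]
    exact h.neg_ne 1 (2 * (j + N)) 0 0 2 0 (by omega) (by field_simp)
  have n2 (m : ℕ) : ellFactorial (-a / q ^ 2) q p m ≠ 0 :=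
    ellFactorial_ne_zero (fun l => by
      rw [neg_div, neg_mul]
      exact h.neg_ne 1 l 0 0 2 0 (by omega) (by field_simp)) m
  have n3 (m : ℕ) : ellFactorial (q ^ 2) q p m ≠ 0 :=
    ellFactorial_ne_zero (fun l => h.ne 0 (2 + l) 0 0 0 0 (by omega) (by ring)) m
  have n4 (m : ℕ) : ellFactorial (a / q ^ 4) (q ^ 2) (p ^ 2) m ≠ 0 :=
    ellFactorial_ne_zero (fun l => h.sq.ne 1 (2 * l) 0 0 4 0 (by omega) (by field_simp; ring)) m
  have n5 (m : ℕ) : ellFactorial (a * q ^ 2) (q ^ 2) (p ^ 2) m ≠ 0 :=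
    ellFactorial_ne_zero (fun l => h.sq.ne 1 (2 + 2 * l) 0 0 0 0 (by omega) (by ring)) m
  have n6 : ellTheta (-a / q ^ 2 * q ^ (2 * j)) p ≠ 0 := by
    rw [neg_div, neg_mul]
    exact h.neg_ne 1 (2 * j) 0 0 2 0 (by omega) (by field_simp)
  have n7 (m : ℕ) : ellFactorial (-q) q p m ≠ 0 :=
    ellFactorial_ne_zero (fun l => by
      rw [neg_mul]
      exact h.neg_ne 0 (1 + l) 0 0 0 0 (by omega) (by ring)) m
  have n8 (m : ℕ) : ellFactorial (a / q ^ 3) q p m ≠ 0 :=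
    ellFactorial_ne_zero (fun l => h.ne 1 l 0 0 3 0 (by omega) (by field_simp)) m
  have n9 (m : ℕ) : ellFactorial q q p m ≠ 0 :=
    ellFactorial_ne_zero (fun l => h.ne 0 (1 + l) 0 0 0 0 (by omega) (by ring)) m
  have n10 : ellTheta q p ≠ 0 := h.ne 0 1 0 0 0 0 (by omega) (by ring)
  have n11 : ellTheta (-q) p ≠ 0 := h.neg_ne 0 1 0 0 0 0 (by omega) (by ring)
  have n12 : ellTheta (-a / q ^ 2) p ≠ 0 := by
    rw [neg_div]
    exact h.neg_ne 1 0 0 0 2 0 (by omega) (by field_simp)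
  have n13 : ellTheta (q ^ (2 * j + 1)) p ≠ 0 :=
    h.ne 0 (2 * j + 1) 0 0 0 0 (by omega) (by ring)
  have n14 : ellFactorial (q ^ (j + N) * q ^ 2) q p j ≠ 0 :=
    ellFactorial_ne_zero (fun l => h.ne 0 (j + N + 2 + l) 0 0 0 0 (by omega) (by ring)) j
  have n15 : ellFactorial (a * (q ^ (2 * (j + N)) * q ^ 2)) (q ^ 2) (p ^ 2) j ≠ 0 :=
    ellFactorial_ne_zero (fun l =>
      h.sq.ne 1 (2 * (j + N) + 2 + 2 * l) 0 0 0 0 (by omega) (by ring)) j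
  have n16 : ellFactorial (q ^ 6 / q ^ (2 * (j + N)) / a) (q ^ 2) (p ^ 2) j ≠ 0 :=
    right_ne_zero_of_mul (right_ne_zero_of_mul (r2 ▸ n4 (N + j)))
  have n17 : ellFactorial (q ^ 4 / q ^ (j + N) / a) q p j ≠ 0 :=
    right_ne_zero_of_mul (right_ne_zero_of_mul (r14 ▸ n8 (N + j)))
  have n18 : ellFactorial (-(a * (q ^ (j + N) / q ^ 2))) q p j ≠ 0 :=
    ellFactorial_ne_zero (fun l => by
      rw [neg_mul]
      exact h.neg_ne 1 (j + N + l) 0 0 2 0 (by omega) (by field_simp; ring)) j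
  have m1 := n2 (j + N)
  have m2 := n2 (2 * j)
  have m3 := n3 (j + N)
  have m4 := n3 (2 * j)
  have m5 := n4 N
  have m6 := n5 (j + N)
  have m7 := n5 (2 * j)
  have m8 := n7 N
  have m9 := n7 (2 * j)
  have m10 := n8 N
  have m11 := n9 (2 * j)
  clear n2 n3 n4 n5 n7 n8 n9
  rw [r3, r4, r5, r6]
  rw [r7] at key
  rw [add_comm N j] at r2 r13 r14
  rw [r2, r13, r14,
    show -(a * (q ^ (2 * (j + N)) / q ^ 2)) = -a * q ^ (2 * (j + N)) / q ^ 2 by ring,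
    show (q ^ 3 / a) ^ j = q ^ j * q ^ (2 * j) / a ^ j by rw [div_pow]; ring,
    show (q ^ 2 / a) ^ j = q ^ (2 * j) / a ^ j by rw [div_pow]; ring]
  have hnN : q ^ (j + N) = q ^ j * q ^ N := pow_add q j N
  clear r2 r3 r4 r5 r6 r7 r13 r14 hprod z1 z2 h hp hp2 hq2
  have hj : q ^ j ≠ 0 := by positivity
  have hN : q ^ N ≠ 0 := by positivity
  have haj : a ^ j ≠ 0 := by positivity
  generalize (∏ l ∈ Finset.range j, -(-q ^ (j + N) / q ^ l)) = Q₁ at *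
  generalize (∏ l ∈ Finset.range j, -(a * q ^ (j + N) / q ^ 4 / q ^ l)) = Q₂ at *
  generalize ellTheta (-a * q ^ (2 * (j + N)) / q ^ 2) p = t₁ at *
  generalize ellTheta (-a / q ^ 2 * q ^ (2 * j)) p = t₂ at *
  generalize ellTheta (-a / q ^ 2) p = t₃ at *
  generalize ellTheta (q ^ (2 * j + 1)) p = t₄ at *
  generalize ellTheta (-q ^ (2 * j + 1)) p = t₅ at *
  generalize ellTheta q p = t₆ at *
  generalize ellTheta (-q) p = t₇ at *
  generalize quadTerminating p q (q ^ (2 * j + 1)) (q ^ 2 / a) N = T at *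
  generalize ellFactorial (-q) q p N = s₁ at *
  generalize ellFactorial (a / q ^ 3) q p N = s₂ at *
  generalize ellFactorial (a * q ^ 2 * (q ^ 2) ^ (2 * j)) (q ^ 2) (p ^ 2) N = s₃ at *
  generalize ellFactorial (-a / q ^ 2 * q ^ (2 * j)) q p N = s₄ at *
  generalize ellFactorial (q ^ 2 * q ^ (2 * j)) q p N = s₅ at *
  generalize ellFactorial (a / q ^ 4) (q ^ 2) (p ^ 2) N = s₆ at *
  generalize ellFactorial (a * q ^ 2) (q ^ 2) (p ^ 2) (j + N) = s₇ at *
  generalize ellFactorial (a * (q ^ (2 * (j + N)) * q ^ 2)) (q ^ 2) (p ^ 2) j = s₈ at *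
  generalize ellFactorial (a * q ^ 2) (q ^ 2) (p ^ 2) (2 * j) = s₉ at *
  generalize ellFactorial (-a / q ^ 2) q p (j + N) = s₁₀ at *
  generalize ellFactorial (-(a * (q ^ (j + N) / q ^ 2))) q p j = s₁₁ at *
  generalize ellFactorial (-a / q ^ 2) q p (2 * j) = s₁₂ at *
  generalize ellFactorial (-a / q) q p (2 * j) = s₁₃ at *
  generalize ellFactorial (q ^ 2) q p (j + N) = s₁₄ at *
  generalize ellFactorial (q ^ (j + N) * q ^ 2) q p j = s₁₅ at *
  generalize ellFactorial (q ^ 2) q p (2 * j) = s₁₆ at *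
  generalize ellFactorial q q p (2 * j) = s₁₇ at *
  generalize ellFactorial (-q) q p (2 * j) = s₁₈ at *
  generalize ellFactorial (-q ^ 2) q p (2 * j) = s₁₉ at *
  generalize ellFactorial (q ^ 6 / q ^ (2 * (j + N)) / a) (q ^ 2) (p ^ 2) j = s₂₀ at *
  generalize ellFactorial (q ^ 4 / q ^ (j + N) / a) q p j = s₂₁ at *
  generalize ellFactorial (a * (q ^ (j + N) / q ^ 2)) q p j = s₂₂ at *
  generalize ellFactorial (q ^ (j + N))⁻¹ q p j = s₂₃ at *
  generalize ellFactorial (-(q ^ (j + N))⁻¹) q p j = s₂₄ at *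
  rw [hnN, show q ^ (2 * j) = (q ^ j) ^ 2 by ring]
  generalize q ^ j = c₁ at *
  generalize q ^ N = c₃ at *
  generalize a ^ j = c₄ at *
  clear hn hnN
  -- each relation is solved for one factor
  obtain rfl : s₃ = s₇ * s₈ / s₉ := by rw [eq_div_iff m7]; linear_combination -r1
  obtain rfl : s₄ = s₁₀ * s₁₁ / s₁₂ := by rw [eq_div_iff m2]; linear_combination -r8
  obtain rfl : s₁₃ = s₁₂ * t₂ / t₃ := by rw [eq_div_iff n12]; linear_combination -r9
  obtain rfl : s₅ = s₁₄ * s₁₅ / s₁₆ := by rw [eq_div_iff m4]; linear_combination -r10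
  obtain rfl : s₁₆ = s₁₇ * t₄ / t₆ := by rw [eq_div_iff n10]; linear_combination -r11
  obtain rfl : s₁₉ = s₁₈ * t₅ / t₇ := by rw [eq_div_iff n11]; linear_combination -r12
  field_simp at key ⊢
  linear_combination (s₂₄ * s₂₂ * s₂₃) * key

/-- The `j`-th basis function of the very-well-poised expansion. -/
noncomputable def expBasis (p q a b : ℂ) (j : ℕ) : ℂ :=
  ellTheta (a * q ^ (4 * j)) p / ellTheta a p *
    ((-a) ^ j * ellFactorial (a ^ 2) (q ^ 4) p j *
      (ellFactorial (a * q / b) (q ^ 2) p j * ellFactorial (b * q / a) (q ^ 2) p j) /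
    (ellFactorial (q ^ 4) (q ^ 4) p j *
      (ellFactorial (b * q) (q ^ 2) p j * ellFactorial (a ^ 2 * q / b) (q ^ 2) p j)))

/-- `expTarget_eq_expSum` in the form of an expansion in the functions `expBasis`. -/
lemma expTarget_eq_sum {p q a b : ℂ} (h : MulIndep p q a b) (k : ℕ) :
    expTarget p q a b k =
      ∑ j ∈ Finset.range (k + 1), expCoupling p q a k j * expBasis p q a b j := by
  have key := expTarget_eq_expSum h k
  have n1 : ellTheta a p ≠ 0 := h.ne 1 0 0 0 0 0 (by omega) (by ring)
  have n2 : ellFactorial (a * q ^ 2) (q ^ 2) p k ≠ 0 :=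
    ellFactorial_ne_zero (fun l => h.ne 1 (2 + 2 * l) 0 0 0 0 (by omega) (by ring)) k
  rw [← eq_div_iff (mul_ne_zero n1 n2)] at key
  rw [key, expSum, Finset.mul_sum, Finset.sum_div]
  refine Finset.sum_congr rfl fun j _ => ?_
  unfold expCoupling expBasis expWeight
  rw [show ((q ^ 2) ^ j) ^ 2 = q ^ (4 * j) by ring]
  ring

/-- Expansion of the right-hand side, with the order of the two summations interchanged. -/
lemma sum_outerCoeff_mul {p q a b : ℂ} (h : MulIndep p q a b) (n : ℕ) :
    outerConst p q a n *
        ∑ k ∈ Finset.range (n + 1), outerCoeff p q a n k * expTarget (p ^ 2) q a b k =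
      ∑ j ∈ Finset.range (n + 1), expBasis (p ^ 2) q a b j *
        (ellFactorial (a ^ 2 * q ^ (2 * (n : ℤ) - 4)) (q ^ 2) (p ^ 2) j *
          ellFactorial (q ^ (-2 * (n : ℤ))) (q ^ 2) (p ^ 2) j *
          ellFactorial (-q ^ 2) q p (2 * j) /
        (ellFactorial (q ^ (6 - 2 * (n : ℤ)) / a) (q ^ 2) (p ^ 2) j *
          ellFactorial (a * q ^ (2 * (n : ℤ) + 2)) (q ^ 2) (p ^ 2) j *
          ellFactorial (-a / q) q p (2 * j)) * (q ^ 3 / a) ^ j) := by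
  simp only [expTarget_eq_sum h.sq, Finset.mul_sum]
  have flip := Finset.sum_range_diag_flip (n + 1) fun j i => outerConst p q a n *
    (outerCoeff p q a n (j + i) * (expCoupling (p ^ 2) q a (j + i) j * expBasis (p ^ 2) q a b j))
  refine Eq.trans (Finset.sum_congr rfl fun k _ => Finset.sum_congr rfl fun j hj => ?_)
    (flip.trans (Finset.sum_congr rfl fun j hj => ?_))
  · rw [Nat.add_sub_cancel' (Nat.lt_succ_iff.mp (Finset.mem_range.mp hj))]
  · obtain ⟨N, rfl⟩ := Nat.exists_eq_add_of_le (Nat.lt_succ_iff.mp (Finset.mem_range.mp hj))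
    rw [← outerConst_mul_quadTerminating h, show j + N + 1 - j = N + 1 by omega, quadTerminating,
      quadSum, ← Finset.mul_sum]
    simp only [Finset.mul_sum]
    refine Finset.sum_congr rfl fun i _ => ?_
    linear_combination (outerConst p q a (j + N) * expBasis (p ^ 2) q a b j) *
      outerCoeff_mul_expCoupling h N j i

/-- The left-hand side of the transformation. -/
noncomputable def leftSeries (p : ℂ) (n : ℕ) (q a b : ℂ) : ℂ :=
  ∑ j ∈ Finset.range (n + 1),
    (ellTheta (a * q ^ (4 * j)) (p ^ 2)
      * (ellFactorial (a ^ 2 * q ^ (2 * (n : ℤ) - 4)) (q ^ 2) (p ^ 2) j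
        * ellFactorial (q ^ (-2 * (n : ℤ))) (q ^ 2) (p ^ 2) j
        * ellFactorial (a * q / b) (q ^ 2) (p ^ 2) j
        * ellFactorial (b * q / a) (q ^ 2) (p ^ 2) j)
      * ellFactorial (-q ^ 2) q p (2 * j)
      * ellFactorial (a ^ 2) (q ^ 4) (p ^ 2) j)
    / (ellTheta a (p ^ 2)
      * (ellFactorial (q ^ (6 - 2 * (n : ℤ)) / a) (q ^ 2) (p ^ 2) j
        * ellFactorial (a * q ^ (2 * (n : ℤ) + 2)) (q ^ 2) (p ^ 2) j
        * ellFactorial (b * q) (q ^ 2) (p ^ 2) j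
        * ellFactorial (a ^ 2 * q / b) (q ^ 2) (p ^ 2) j)
      * ellFactorial (-a / q) q p (2 * j)
      * ellFactorial (q ^ 4) (q ^ 4) (p ^ 2) j)
    * ((-1) ^ j * q ^ (3 * j))

/-- The right-hand side of the transformation. -/
noncomputable def rightSeries (p : ℂ) (n : ℕ) (q a b : ℂ) : ℂ :=
  (ellTheta (-a / q ^ 2) p
    * (ellFactorial (-q) q p n * ellFactorial (a / q ^ 3) q p n)
    * ellFactorial (a * q ^ 2) (q ^ 2) (p ^ 2) n)
  / (ellTheta (-a * q ^ (2 * (n : ℤ) - 2)) p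
    * (ellFactorial (-a / q ^ 2) q p n * ellFactorial (q ^ 2) q p n)
    * ellFactorial (a / q ^ 4) (q ^ 2) (p ^ 2) n)
  * q ^ (-(n : ℤ))
  * ∑ k ∈ Finset.range (n + 1),
    (ellTheta (q ^ (4 * k + 2)) (p ^ 2)
      * (ellFactorial (a * q ^ ((n : ℤ) - 2)) q p k
        * ellFactorial (q ^ (-(n : ℤ))) q p k)
      * ellFactorial (b * q / a ^ 2) (q ^ 2) (p ^ 2) k
      * ellFactorial (b * q ^ (1 - 2 * (k : ℤ))) (q ^ 4) (p ^ 2) k)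
    / (ellTheta (q ^ 2) (p ^ 2)
      * (ellFactorial (q ^ (4 - (n : ℤ)) / a) q p k
        * ellFactorial (q ^ ((n : ℤ) + 2)) q p k)
      * ellFactorial (b * q) (q ^ 2) (p ^ 2) k
      * ellFactorial (b * q ^ (1 - 2 * (k : ℤ)) / a ^ 2) (q ^ 4) (p ^ 2) k)
    * (-q ^ 2 / a) ^ k

/-- The transformation for multiplicatively independent parameters. -/
lemma leftSeries_eq_rightSeries {p q a b : ℂ} (h : MulIndep p q a b) (n : ℕ) :
    leftSeries p n q a b = rightSeries p n q a b := by
  have key := sum_outerCoeff_mul h n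
  have ha := h.a_ne
  unfold leftSeries rightSeries
  refine Eq.trans (Finset.sum_congr rfl fun j _ => ?_) (key.symm.trans ?_)
  · unfold expBasis
    have e : (-a) ^ j * (q ^ 3 / a) ^ j = (-1) ^ j * q ^ (3 * j) := by
      rw [← mul_pow, pow_mul, ← mul_pow]
      congr 1
      field_simp
    rw [← e]
    ring
  · rw [outerConst]
    congr 1
    refine Finset.sum_congr rfl fun k _ => ?_
    unfold outerCoeff expTarget
    ring

section

open Filter Topology

/-! ### Continuity and genericity -/

lemma ContinuousAt.ellTheta {p : ℂ} (hp : ‖p‖ < 1) {x : ℝ → ℂ} {t : ℝ} (hx : ContinuousAt x t)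
    (h : x t ≠ 0) : ContinuousAt (fun t => ellTheta (x t) p) t :=
  (continuousAt_ellTheta hp h).comp (f := x) hx

lemma ContinuousAt.ellFactorial {p : ℂ} (hp : ‖p‖ < 1) {x q : ℝ → ℂ} {t : ℝ}
    (hx : ContinuousAt x t) (hq : ContinuousAt q t) (h : x t ≠ 0) (h' : q t ≠ 0) (k : ℕ) :
    ContinuousAt (fun t => ellFactorial (x t) (q t) p k) t := by
  unfold _root_.ellFactorial
  exact tendsto_finsetProd _ fun i _ => ContinuousAt.ellTheta hp (hx.mul (hq.pow i))
    (mul_ne_zero h (pow_ne_zero i h'))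

lemma finite_setOf_cubic_eq {x y z : ℝ} (hne : ¬(x = 0 ∧ y = 0 ∧ z = 0)) (c : ℝ) :
    {t : ℝ | x * t + y * t ^ 2 + z * t ^ 3 = c}.Finite := by
  let P : Polynomial ℝ := Polynomial.C x * Polynomial.X + Polynomial.C y * Polynomial.X ^ 2 +
    Polynomial.C z * Polynomial.X ^ 3 - Polynomial.C c
  have hP : P ≠ 0 := by
    intro h
    have hc (k : ℕ) : P.coeff k = 0 := by rw [h, Polynomial.coeff_zero]
    refine hne ⟨?_, ?_, ?_⟩
    · simpa [P, Polynomial.coeff_X, Polynomial.coeff_C] using hc 1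
    · simpa [P, Polynomial.coeff_X, Polynomial.coeff_C] using hc 2
    · simpa [P, Polynomial.coeff_X, Polynomial.coeff_C] using hc 3
  refine P.roots.toFinset.finite_toSet.subset fun t ht => ?_
  rw [Set.mem_ofPred_eq] at ht
  simp [P, hP, ht]

/-- A monomial in the perturbed parameters takes a given value for finitely many parameters. -/
lemma finite_setOf_monomial_eq {a q b : ℂ} (ha : a ≠ 0) (hq : q ≠ 0) (hb : b ≠ 0) (i l m : ℤ)
    (hne : ¬(i = 0 ∧ l = 0 ∧ m = 0)) (c : ℂ) :
    {t : ℝ | (a * Real.exp t) ^ i * (q * Real.exp (t ^ 2)) ^ l *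
      (b * Real.exp (t ^ 3)) ^ m = c}.Finite := by
  rcases Set.eq_empty_or_nonempty {t : ℝ | (a * Real.exp t) ^ i * (q * Real.exp (t ^ 2)) ^ l *
    (b * Real.exp (t ^ 3)) ^ m = c} with h | ⟨t₀, h₀⟩
  · rw [h]; exact Set.finite_empty
  have e : ∀ t : ℝ,
      (a * Real.exp t) ^ i * (q * Real.exp (t ^ 2)) ^ l * (b * Real.exp (t ^ 3)) ^ m =
      a ^ i * q ^ l * b ^ m * (Real.exp (i * t + l * t ^ 2 + m * t ^ 3) : ℝ) := by
    intro t
    push_cast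
    rw [Complex.exp_add, Complex.exp_add, Complex.exp_int_mul, Complex.exp_int_mul,
      Complex.exp_int_mul, mul_zpow, mul_zpow, mul_zpow]
    ring
  -- for real `t` the exponential factor determines its cubic exponent
  refine (finite_setOf_cubic_eq (x := i) (y := l) (z := m) (by exact_mod_cast hne)
    (i * t₀ + l * t₀ ^ 2 + m * t₀ ^ 3)).subset fun t ht => ?_
  rw [Set.mem_ofPred_eq, e] at ht h₀
  have h1 := mul_left_cancel₀ (by positivity) (ht.trans h₀.symm)
  have h2 := Real.exp_injective (Complex.ofReal_injective h1)
  exact h2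

/-- Any nonzero parameters are limits of multiplicatively independent ones along a curve. -/
lemma exists_curve_mulIndep {p q a b : ℂ} (hp : ‖p‖ < 1) (hq : q ≠ 0) (ha : a ≠ 0) (hb : b ≠ 0) :
    ∃ Q A B : ℝ → ℂ, ContinuousAt Q 0 ∧ ContinuousAt A 0 ∧ ContinuousAt B 0 ∧
      Q 0 = q ∧ A 0 = a ∧ B 0 = b ∧ ∃ᶠ t in 𝓝 (0 : ℝ), MulIndep p (Q t) (A t) (B t) := by
  refine ⟨fun t => q * Real.exp (t ^ 2), fun t => a * Real.exp t, fun t => b * Real.exp (t ^ 3),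
    by fun_prop, by fun_prop, by fun_prop, by simp, by simp, by simp, ?_⟩
  -- countably many resonances, each of them met for finitely many `t`
  let bad : Set ℝ := ⋃ v : {v : ℤ × ℤ × ℤ × ℤ // ¬(v.1 = 0 ∧ v.2.1 = 0 ∧ v.2.2.1 = 0)},
    {t : ℝ | (a * Real.exp t) ^ v.1.1 * (q * Real.exp (t ^ 2)) ^ v.1.2.1 *
      (b * Real.exp (t ^ 3)) ^ v.1.2.2.1 = p ^ v.1.2.2.2}
  have hbad : bad.Countable :=
    Set.countable_iUnion fun v => (finite_setOf_monomial_eq ha hq hb _ _ _ v.2 _).countable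
  refine (mem_closure_iff_frequently.mp (hbad.dense_compl ℝ 0)).mono fun t ht => ?_
  have he (x : ℝ) : (Real.exp x : ℂ) ≠ 0 := by exact_mod_cast Real.exp_ne_zero x
  refine ⟨hp, mul_ne_zero hq (he _), mul_ne_zero ha (he _), mul_ne_zero hb (he _),
    fun i l m r h => ?_⟩
  by_contra hne
  exact ht (Set.mem_iUnion.mpr ⟨⟨(i, l, m, r), hne⟩, h⟩)

lemma continuousAt_leftSeries {p : ℂ} (hp : ‖p‖ < 1) (n : ℕ) {Q A B : ℝ → ℂ}
    (cQ : ContinuousAt Q 0) (cA : ContinuousAt A 0) (cB : ContinuousAt B 0)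
    (hq : Q 0 ≠ 0) (ha : A 0 ≠ 0) (hb : B 0 ≠ 0)
    (hL : ∀ j ∈ Finset.range (n + 1),
      ellTheta (A 0) (p ^ 2)
        * (ellFactorial (Q 0 ^ (6 - 2 * (n : ℤ)) / A 0) (Q 0 ^ 2) (p ^ 2) j
          * ellFactorial (A 0 * Q 0 ^ (2 * (n : ℤ) + 2)) (Q 0 ^ 2) (p ^ 2) j
          * ellFactorial (B 0 * Q 0) (Q 0 ^ 2) (p ^ 2) j
          * ellFactorial (A 0 ^ 2 * Q 0 / B 0) (Q 0 ^ 2) (p ^ 2) j)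
        * ellFactorial (-A 0 / Q 0) (Q 0) p (2 * j)
        * ellFactorial (Q 0 ^ 4) (Q 0 ^ 4) (p ^ 2) j ≠ 0) :
    ContinuousAt (fun t => leftSeries p n (Q t) (A t) (B t)) 0 := by
  have hp2 := norm_sq_lt_one hp
  unfold leftSeries
  refine tendsto_finsetSum _ fun j hj => ContinuousAt.mul (ContinuousAt.div
    ((((ContinuousAt.ellTheta hp2 ?_ ?_).mul
      ((((ContinuousAt.ellFactorial hp2 ?_ ?_ ?_ ?_ _).mul
      (ContinuousAt.ellFactorial hp2 ?_ ?_ ?_ ?_ _)).mul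
      (ContinuousAt.ellFactorial hp2 ?_ ?_ ?_ ?_ _)).mul
      (ContinuousAt.ellFactorial hp2 ?_ ?_ ?_ ?_ _))).mul
      (ContinuousAt.ellFactorial hp ?_ ?_ ?_ ?_ _)).mul
      (ContinuousAt.ellFactorial hp2 ?_ ?_ ?_ ?_ _))
    ((((ContinuousAt.ellTheta hp2 ?_ ?_).mul
      ((((ContinuousAt.ellFactorial hp2 ?_ ?_ ?_ ?_ _).mul
      (ContinuousAt.ellFactorial hp2 ?_ ?_ ?_ ?_ _)).mul
      (ContinuousAt.ellFactorial hp2 ?_ ?_ ?_ ?_ _)).mul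
      (ContinuousAt.ellFactorial hp2 ?_ ?_ ?_ ?_ _))).mul
      (ContinuousAt.ellFactorial hp ?_ ?_ ?_ ?_ _)).mul
      (ContinuousAt.ellFactorial hp2 ?_ ?_ ?_ ?_ _)) (hL j hj)) ?_
  all_goals first
    | fun_prop (disch := first | assumption | exact Or.inl (by assumption) | positivity)
    | positivity
    | exact div_ne_zero (neg_ne_zero.mpr ha) (by positivity)
    | exact mul_ne_zero (neg_ne_zero.mpr ha) (by positivity)
    | exact neg_ne_zero.mpr (by positivity)

lemma continuousAt_rightSeries {p : ℂ} (hp : ‖p‖ < 1) (n : ℕ) {Q A B : ℝ → ℂ}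
    (cQ : ContinuousAt Q 0) (cA : ContinuousAt A 0) (cB : ContinuousAt B 0)
    (hq : Q 0 ≠ 0) (ha : A 0 ≠ 0) (hb : B 0 ≠ 0)
    (hC : ellTheta (-A 0 * Q 0 ^ (2 * (n : ℤ) - 2)) p
        * (ellFactorial (-A 0 / Q 0 ^ 2) (Q 0) p n * ellFactorial (Q 0 ^ 2) (Q 0) p n)
        * ellFactorial (A 0 / Q 0 ^ 4) (Q 0 ^ 2) (p ^ 2) n ≠ 0)
    (hR : ∀ k ∈ Finset.range (n + 1),
      ellTheta (Q 0 ^ 2) (p ^ 2)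
        * (ellFactorial (Q 0 ^ (4 - (n : ℤ)) / A 0) (Q 0) p k
          * ellFactorial (Q 0 ^ ((n : ℤ) + 2)) (Q 0) p k)
        * ellFactorial (B 0 * Q 0) (Q 0 ^ 2) (p ^ 2) k
        * ellFactorial (B 0 * Q 0 ^ (1 - 2 * (k : ℤ)) / A 0 ^ 2) (Q 0 ^ 4) (p ^ 2) k ≠ 0) :
    ContinuousAt (fun t => rightSeries p n (Q t) (A t) (B t)) 0 := by
  have hp2 := norm_sq_lt_one hp
  unfold rightSeries
  refine ContinuousAt.mul (ContinuousAt.mul (ContinuousAt.div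
    (((ContinuousAt.ellTheta hp ?_ ?_).mul
      ((ContinuousAt.ellFactorial hp ?_ ?_ ?_ ?_ _).mul
      (ContinuousAt.ellFactorial hp ?_ ?_ ?_ ?_ _))).mul
      (ContinuousAt.ellFactorial hp2 ?_ ?_ ?_ ?_ _))
    (((ContinuousAt.ellTheta hp ?_ ?_).mul
      ((ContinuousAt.ellFactorial hp ?_ ?_ ?_ ?_ _).mul
      (ContinuousAt.ellFactorial hp ?_ ?_ ?_ ?_ _))).mul
      (ContinuousAt.ellFactorial hp2 ?_ ?_ ?_ ?_ _)) hC) ?_)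
    (tendsto_finsetSum _ fun k hk => ContinuousAt.mul (ContinuousAt.div
    ((((ContinuousAt.ellTheta hp2 ?_ ?_).mul
      ((ContinuousAt.ellFactorial hp ?_ ?_ ?_ ?_ _).mul
      (ContinuousAt.ellFactorial hp ?_ ?_ ?_ ?_ _))).mul
      (ContinuousAt.ellFactorial hp2 ?_ ?_ ?_ ?_ _)).mul
      (ContinuousAt.ellFactorial hp2 ?_ ?_ ?_ ?_ _))
    ((((ContinuousAt.ellTheta hp2 ?_ ?_).mul
      ((ContinuousAt.ellFactorial hp ?_ ?_ ?_ ?_ _).mul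
      (ContinuousAt.ellFactorial hp ?_ ?_ ?_ ?_ _))).mul
      (ContinuousAt.ellFactorial hp2 ?_ ?_ ?_ ?_ _)).mul
      (ContinuousAt.ellFactorial hp2 ?_ ?_ ?_ ?_ _)) (hR k hk)) ?_)
  all_goals first
    | fun_prop (disch := first | assumption | exact Or.inl (by assumption) | positivity)
    | positivity
    | exact div_ne_zero (neg_ne_zero.mpr ha) (by positivity)
    | exact mul_ne_zero (neg_ne_zero.mpr ha) (by positivity)
    | exact neg_ne_zero.mpr (by positivity)


end

theorem mainTheorem8 (n : ℕ) (a b q p : ℂ)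
    (ha : a ≠ 0) (hb : b ≠ 0) (hq : q ≠ 0) (hp : ‖p‖ < 1)
    -- no denominator displayed in the identity vanishes
    (hL : ∀ j ∈ Finset.range (n + 1),
      ellTheta a (p ^ 2)
        * (ellFactorial (q ^ (6 - 2 * (n : ℤ)) / a) (q ^ 2) (p ^ 2) j
          * ellFactorial (a * q ^ (2 * (n : ℤ) + 2)) (q ^ 2) (p ^ 2) j
          * ellFactorial (b * q) (q ^ 2) (p ^ 2) j
          * ellFactorial (a ^ 2 * q / b) (q ^ 2) (p ^ 2) j)
        * ellFactorial (-a / q) q p (2 * j)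
        * ellFactorial (q ^ 4) (q ^ 4) (p ^ 2) j ≠ 0)
    (hC : ellTheta (-a * q ^ (2 * (n : ℤ) - 2)) p
        * (ellFactorial (-a / q ^ 2) q p n * ellFactorial (q ^ 2) q p n)
        * ellFactorial (a / q ^ 4) (q ^ 2) (p ^ 2) n ≠ 0)
    (hR : ∀ k ∈ Finset.range (n + 1),
      ellTheta (q ^ 2) (p ^ 2)
        * (ellFactorial (q ^ (4 - (n : ℤ)) / a) q p k
          * ellFactorial (q ^ ((n : ℤ) + 2)) q p k)
        * ellFactorial (b * q) (q ^ 2) (p ^ 2) k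
        * ellFactorial (b * q ^ (1 - 2 * (k : ℤ)) / a ^ 2) (q ^ 4) (p ^ 2) k ≠ 0) :
    ∑ j ∈ Finset.range (n + 1),
      (ellTheta (a * q ^ (4 * j)) (p ^ 2)
        * (ellFactorial (a ^ 2 * q ^ (2 * (n : ℤ) - 4)) (q ^ 2) (p ^ 2) j
          * ellFactorial (q ^ (-2 * (n : ℤ))) (q ^ 2) (p ^ 2) j
          * ellFactorial (a * q / b) (q ^ 2) (p ^ 2) j
          * ellFactorial (b * q / a) (q ^ 2) (p ^ 2) j)
        * ellFactorial (-q ^ 2) q p (2 * j)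
        * ellFactorial (a ^ 2) (q ^ 4) (p ^ 2) j)
      / (ellTheta a (p ^ 2)
        * (ellFactorial (q ^ (6 - 2 * (n : ℤ)) / a) (q ^ 2) (p ^ 2) j
          * ellFactorial (a * q ^ (2 * (n : ℤ) + 2)) (q ^ 2) (p ^ 2) j
          * ellFactorial (b * q) (q ^ 2) (p ^ 2) j
          * ellFactorial (a ^ 2 * q / b) (q ^ 2) (p ^ 2) j)
        * ellFactorial (-a / q) q p (2 * j)
        * ellFactorial (q ^ 4) (q ^ 4) (p ^ 2) j)
      * ((-1) ^ j * q ^ (3 * j))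
    = (ellTheta (-a / q ^ 2) p
        * (ellFactorial (-q) q p n * ellFactorial (a / q ^ 3) q p n)
        * ellFactorial (a * q ^ 2) (q ^ 2) (p ^ 2) n)
      / (ellTheta (-a * q ^ (2 * (n : ℤ) - 2)) p
        * (ellFactorial (-a / q ^ 2) q p n * ellFactorial (q ^ 2) q p n)
        * ellFactorial (a / q ^ 4) (q ^ 2) (p ^ 2) n)
      * q ^ (-(n : ℤ))
      * ∑ k ∈ Finset.range (n + 1),
        (ellTheta (q ^ (4 * k + 2)) (p ^ 2)
          * (ellFactorial (a * q ^ ((n : ℤ) - 2)) q p k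
            * ellFactorial (q ^ (-(n : ℤ))) q p k)
          * ellFactorial (b * q / a ^ 2) (q ^ 2) (p ^ 2) k
          * ellFactorial (b * q ^ (1 - 2 * (k : ℤ))) (q ^ 4) (p ^ 2) k)
        / (ellTheta (q ^ 2) (p ^ 2)
          * (ellFactorial (q ^ (4 - (n : ℤ)) / a) q p k
            * ellFactorial (q ^ ((n : ℤ) + 2)) q p k)
          * ellFactorial (b * q) (q ^ 2) (p ^ 2) k
          * ellFactorial (b * q ^ (1 - 2 * (k : ℤ)) / a ^ 2) (q ^ 4) (p ^ 2) k)
        * (-q ^ 2 / a) ^ k := by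
  obtain ⟨Q, A, B, cQ, cA, cB, rfl, rfl, rfl, hfreq⟩ := exists_curve_mulIndep hp hq ha hb
  exact tendsto_nhds_unique_of_frequently_eq (continuousAt_leftSeries hp n cQ cA cB hq ha hb hL)
    (continuousAt_rightSeries hp n cQ cA cB hq ha hb hC hR)
    (hfreq.mono fun t ht => leftSeries_eq_rightSeries ht n)
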